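/- Throughout, $S$ is a countable inverse monoid with a zero element: a countable monoid with $0$ such that each $s\in S$ has a unique $s^*\in S$ with $ss^*s=s$ and $s^*ss^*=s^*$. Let $E(S)$ be its set of idempotents, and order $S$ by $s\leqslant t$ iff $ts^*s=s$. Call $s,t$ compatible if $s^*t,st^*\in E(S)$. $S$ is a *Boolean inverse monoid* if every finite subset $F$ of pairwise compatible elements has a join $\bigvee F$, with $t\bigvee F=\bigvee_{s\in F}ts$ and $(\bigvee F)t=\bigvee_{s\in F}st$ for all $t\in S$, and $E(S)$ is a Boolean algebra (with meet given by the product). For $s\in S$ let $\mathcal J_s=\{e\in E(S)\mid se=e\}$. A subset $C\subset X\subset E(S)$ is a *cover* of $X$ if for every nonzero $x\in X$ there is $c\in C$ with $cx\neq0$. Condition (H): for every $s\in S$ the set $\mathcal J_s$ has a finite cover. A *filter* in $E(S)$ is a nonempty subset of $E(S)$, not containing $0$, closed under products and upward closed in $E(S)$. The set of filters carries the topology generated by the sets $U(X,Y)=\{\xi\mid X\subset\xi,\ Y\cap\xi=\emptyset\}$, with $X,Y\subset E(S)$ finite. The *tight spectrum* $\widehat E_{\rm tight}(S)$ is the closure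 of the set of ultrafilters (maximal filters) in the space of filters, with the subspace topology. Put $D_e=\{\xi\in\widehat E_{\rm tight}(S)\mid e\in\xi\}$ for $e\in E(S)$. The standard action of $S$ is given by the maps $\theta_s:D_{s^*s}\to D_{ss^*}$, where $\theta_s(\xi)$ is the set of all $f\in E(S)$ with $ses^*\leqslant f$ for some $e\in\xi$. The *tight groupoid* $\mathcal G_{\rm tight}(S)$ is the groupoid of germs of $\theta$. Its arrows are the classes $[s,x]$ of pairs $(s,x)$ with $x\in D_{s^*s}$, where $(s,x)\sim(t,y)$ iff $x=y$ and $se=te$ for some $e\in E(S)$ with $x\in D_e$. Its unit space is $\widehat E_{\rm tight}(S)$, with $d([s,x])=x$, $r([s,x])=\theta_s(x)$, $[s,x]^{-1}=[s^*,\theta_s(x)]$ and $[t,\theta_s(x)][s,x]=[ts,x]$. Its topology is generated by the sets $\{[s,x]\mid x\in U\}$ with $s\in S$ and $U\subset D_{s^*s}$ open. A *bisection* is an open set of arrows on which $r$ and $d$ are injective. Let $IM(\mathcal G_{\rm tight}(S))$ be the convex set of regular Borel probability measures $\nu$ on $\widehat E_{\rm tight}(S)$ such that $\nu(r(U))=\nu(d(U))$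 for every bisection $U$. A *normalized invariant mean* on $S$ is a function $\mu:E(S)\to[0,\infty)$ such that $\mu(s^*s)=\mu(ss^*)$ for all $s\in S$, $\mu(e\vee f)=\mu(e)+\mu(f)$ whenever $ef=0$, and $\mu(1)=1$. Let $M(S)$ be the convex set of all normalized invariant means on $S$. **Proposition.** Let $S$ be a countable Boolean inverse monoid satisfying condition (H). For each $\nu\in IM(\mathcal G_{\rm tight}(S))$, the function $\eta_\nu:E(S)\to[0,\infty)$, $\eta_\nu(e)=\nu(D_e)$, is a normalized invariant mean on $S$. The map $\nu\mapsto\eta_\nu$ is an affine isomorphism from $IM(\mathcal G_{\rm tight}(S))$ onto $M(S)$, i.e. a bijection between these convex sets that preserves convex combinations. -/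

import Mathlib

open scoped NNReal

namespace InverseMonoids

universe u

/-- An inverse monoid with zero: every `s` has a unique generalized inverse, written `s⁻¹`
(denoted `s^*` in the operator-algebraic literature). -/
class InverseMonoidWithZero (S : Type u) extends MonoidWithZero S, Inv S where
  mul_inv_mul : ∀ s : S, s * s⁻¹ * s = s
  inv_mul_inv : ∀ s : S, s⁻¹ * s * s⁻¹ = s⁻¹
  inv_unique : ∀ s t : S, s * t * s = s → t * s * t = t → t = s⁻¹

section Basic

variable {S : Type u} [InverseMonoidWithZero S]

open InverseMonoidWithZero

theorem inv_inv' (s : S) : s⁻¹⁻¹ = s :=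
  (InverseMonoidWithZero.inv_unique s⁻¹ s (inv_mul_inv s) (mul_inv_mul s)).symm

theorem inv_of_idem {e : S} (he : IsIdempotentElem e) : e⁻¹ = e := by
  have h : e * e = e := he
  exact (InverseMonoidWithZero.inv_unique e e (by rw [h, h]) (by rw [h, h])).symm

theorem idem_mul {e f : S} (he : IsIdempotentElem e) (hf : IsIdempotentElem f) :
    IsIdempotentElem (e * f) := by
  have he' : ∀ a : S, e * (e * a) = e * a := fun a => by rw [← mul_assoc, he.eq]
  have hf' : ∀ a : S, f * (f * a) = f * a := fun a => by rw [← mul_assoc, hf.eq]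
  have h1 := mul_inv_mul (e * f)
  have h2 := inv_mul_inv (e * f)
  set x := (e * f)⁻¹ with hx
  simp only [mul_assoc] at h1 h2
  have h2' : ∀ a : S, x * (e * (f * (x * a))) = x * a := fun a => by
    have := congrArg (· * a) h2
    simpa only [mul_assoc] using this
  have hy : f * x * e = x := by
    apply InverseMonoidWithZero.inv_unique
    · simp only [mul_assoc, he', hf']; exact h1
    · simp only [mul_assoc, he', hf', h2']
  have hxx : x * x = x := by
    calc x * x = (f * x * e) * (f * x * e) := by rw [hy]
      _ = f * x * e := by simp only [mul_assoc, h2']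
      _ = x := hy
  have h3 : e * f = x⁻¹ := by rw [hx, inv_inv']
  rw [h3, inv_of_idem hxx]
  exact hxx

theorem idem_comm {e f : S} (he : IsIdempotentElem e) (hf : IsIdempotentElem f) :
    e * f = f * e := by
  have he' : ∀ a : S, e * (e * a) = e * a := fun a => by rw [← mul_assoc, he.eq]
  have hf' : ∀ a : S, f * (f * a) = f * a := fun a => by rw [← mul_assoc, hf.eq]
  have h1 := idem_mul he hf
  have h2 := idem_mul hf he
  have h3 : f * e = (e * f)⁻¹ := by
    apply InverseMonoidWithZero.inv_unique
    · have := h1.eq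
      simp only [mul_assoc, he', hf'] at this ⊢
      exact this
    · have := h2.eq
      simp only [mul_assoc, he', hf'] at this ⊢
      exact this
  rw [h3, inv_of_idem h1]

theorem idem_inv_mul (s : S) : IsIdempotentElem (s⁻¹ * s) := by
  change s⁻¹ * s * (s⁻¹ * s) = s⁻¹ * s
  rw [← mul_assoc, inv_mul_inv]

theorem idem_mul_inv (s : S) : IsIdempotentElem (s * s⁻¹) := by
  change s * s⁻¹ * (s * s⁻¹) = s * s⁻¹
  rw [← mul_assoc, mul_inv_mul]

/-- An idempotent `e` can be moved across `s` by commuting with `s⁻¹ * s`. -/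
theorem mul_idem_inv_mul (s : S) {e : S} (he : IsIdempotentElem e) :
    s * e * s⁻¹ * s = s * e := by
  rw [mul_assoc, mul_assoc, idem_comm he (idem_inv_mul s), ← mul_assoc, ← mul_assoc,
    mul_inv_mul]

theorem idem_conj (s : S) {e : S} (he : IsIdempotentElem e) :
    IsIdempotentElem (s * e * s⁻¹) := by
  change s * e * s⁻¹ * (s * e * s⁻¹) = s * e * s⁻¹
  calc s * e * s⁻¹ * (s * e * s⁻¹) = (s * e * s⁻¹ * s) * e * s⁻¹ := by simp only [mul_assoc]
    _ = s * (e * e) * s⁻¹ := by rw [mul_idem_inv_mul s he]; simp only [mul_assoc]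
    _ = s * e * s⁻¹ := by rw [he.eq]

theorem mul_inv_rev' (s t : S) : (s * t)⁻¹ = t⁻¹ * s⁻¹ := by
  symm
  apply InverseMonoidWithZero.inv_unique
  · calc s * t * (t⁻¹ * s⁻¹) * (s * t) = s * ((t * t⁻¹) * (s⁻¹ * s)) * t := by
          simp only [mul_assoc]
      _ = s * ((s⁻¹ * s) * (t * t⁻¹)) * t := by
          rw [idem_comm (idem_mul_inv t) (idem_inv_mul s)]
      _ = (s * s⁻¹ * s) * (t * t⁻¹ * t) := by simp only [mul_assoc]
      _ = s * t := by rw [mul_inv_mul, mul_inv_mul]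
  · calc t⁻¹ * s⁻¹ * (s * t) * (t⁻¹ * s⁻¹) = t⁻¹ * ((s⁻¹ * s) * (t * t⁻¹)) * s⁻¹ := by
          simp only [mul_assoc]
      _ = t⁻¹ * ((t * t⁻¹) * (s⁻¹ * s)) * s⁻¹ := by
          rw [idem_comm (idem_mul_inv t) (idem_inv_mul s)]
      _ = (t⁻¹ * t * t⁻¹) * (s⁻¹ * s * s⁻¹) := by simp only [mul_assoc]
      _ = t⁻¹ * s⁻¹ := by rw [inv_mul_inv, inv_mul_inv]

/-- The natural partial order of an inverse semigroup: `s ≤ t` iff `t s⁻¹ s = s`. -/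
instance instPartialOrder : PartialOrder S where
  le s t := t * s⁻¹ * s = s
  le_refl s := mul_inv_mul s
  le_trans s t v hst htv := by
    change t * s⁻¹ * s = s at hst
    change v * t⁻¹ * t = t at htv
    have h1 : t⁻¹ * t * (s⁻¹ * s) = s⁻¹ * s := by
      have hs : s = t * (s⁻¹ * s) := by rw [← mul_assoc, hst]
      have h2 : s⁻¹ * s = (s⁻¹ * s) * (t⁻¹ * (t * (s⁻¹ * s))) := by
        conv_lhs => rw [hs, mul_inv_rev', inv_of_idem (idem_inv_mul s)]
        simp only [mul_assoc]
      rw [← mul_assoc t⁻¹, ← mul_assoc, idem_comm (idem_inv_mul s) (idem_inv_mul t),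
        mul_assoc, (idem_inv_mul s).eq] at h2
      exact h2.symm
    calc v * s⁻¹ * s = v * (t⁻¹ * t * (s⁻¹ * s)) := by rw [h1, mul_assoc]
      _ = (v * t⁻¹ * t) * s⁻¹ * s := by simp only [mul_assoc]
      _ = s := by rw [htv, hst]
  le_antisymm s t hst hts := by
    change t * s⁻¹ * s = s at hst
    change s * t⁻¹ * t = t at hts
    calc s = t * s⁻¹ * s := hst.symm
      _ = (s * t⁻¹ * t) * s⁻¹ * s := by rw [hts]
      _ = s * ((t⁻¹ * t) * (s⁻¹ * s)) := by simp only [mul_assoc]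
      _ = s * ((s⁻¹ * s) * (t⁻¹ * t)) := by rw [idem_comm (idem_inv_mul t) (idem_inv_mul s)]
      _ = (s * s⁻¹ * s) * t⁻¹ * t := by simp only [mul_assoc]
      _ = t := by rw [mul_inv_mul, hts]

theorem le_def (s t : S) : s ≤ t ↔ t * s⁻¹ * s = s := Iff.rfl

/-- Two elements are compatible if `s⁻¹ t` and `s t⁻¹` are idempotent. -/
def Compatible (s t : S) : Prop :=
  IsIdempotentElem (s⁻¹ * t) ∧ IsIdempotentElem (s * t⁻¹)

end Basic

/-- The set `E(S)` of idempotents, as a type; it inherits the natural partial order. -/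
abbrev Idem (S : Type u) [InverseMonoidWithZero S] : Type u := {e : S // IsIdempotentElem e}

/-- A distributive inverse monoid: every finite compatible set has a join, and
multiplication on either side preserves such joins. -/
class DistributiveInverseMonoid (S : Type u) extends InverseMonoidWithZero S where
  exists_join : ∀ F : Finset S, (∀ s ∈ F, ∀ t ∈ F, Compatible s t) → ∃ j : S, IsLUB (F : Set S) j
  mul_join : ∀ F : Finset S, (∀ s ∈ F, ∀ t ∈ F, Compatible s t) → ∀ j : S, IsLUB (F : Set S) j →
    ∀ t : S, IsLUB ((fun s => t * s) '' (F : Set S)) (t * j)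
  join_mul : ∀ F : Finset S, (∀ s ∈ F, ∀ t ∈ F, Compatible s t) → ∀ j : S, IsLUB (F : Set S) j →
    ∀ t : S, IsLUB ((fun s => s * t) '' (F : Set S)) (j * t)

/-- A Boolean inverse monoid: a distributive inverse monoid in which every idempotent has an
idempotent complement. (By distributivity `E(S)`, with meet given by the product, is always a
bounded distributive lattice, so the existence of complements is what makes it a Boolean
algebra.) -/
class BooleanInverseMonoid (S : Type u) extends DistributiveInverseMonoid S where
  exists_compl : ∀ e : S, IsIdempotentElem e →
    ∃ f : S, IsIdempotentElem f ∧ e * f = 0 ∧ IsLUB {e, f} (1 : S)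

section Spectrum

variable {S : Type u} [InverseMonoidWithZero S]

open InverseMonoidWithZero

instance : Mul (Idem S) := ⟨fun e f => ⟨e.1 * f.1, idem_mul e.2 f.2⟩⟩

instance : One (Idem S) := ⟨⟨1, IsIdempotentElem.one⟩⟩

@[simp] theorem Idem.coe_mul (e f : Idem S) : ((e * f : Idem S) : S) = (e : S) * (f : S) := rfl

@[simp] theorem Idem.coe_one : ((1 : Idem S) : S) = 1 := rfl

theorem Idem.le_iff (e f : Idem S) : e ≤ f ↔ (f : S) * (e : S) = e := by
  change (f : S) * (e : S)⁻¹ * (e : S) = e ↔ _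
  rw [inv_of_idem e.2, mul_assoc, e.2.eq]

theorem Idem.mul_le_left (e f : Idem S) : e * f ≤ e := by
  rw [Idem.le_iff]; simp only [Idem.coe_mul, ← mul_assoc, e.2.eq]

theorem Idem.mul_le_right (e f : Idem S) : e * f ≤ f := by
  rw [Idem.le_iff]; simp only [Idem.coe_mul]
  rw [idem_comm e.2 f.2, ← mul_assoc, f.2.eq]

theorem Idem.le_one (e : Idem S) : e ≤ 1 := by
  rw [Idem.le_iff]; simp

/-- `s⁻¹ s` as an idempotent. -/
def dom (s : S) : Idem S := ⟨s⁻¹ * s, idem_inv_mul s⟩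

/-- `s s⁻¹` as an idempotent. -/
def ran (s : S) : Idem S := ⟨s * s⁻¹, idem_mul_inv s⟩

/-- `s e s⁻¹` as an idempotent. -/
def conj (s : S) (e : Idem S) : Idem S := ⟨s * e * s⁻¹, idem_conj s e.2⟩

variable (S) in
/-- The (proper) filters in `E(S)`. -/
@[ext] structure IdemFilter where
  carrier : Set (Idem S)
  nonempty : carrier.Nonempty
  ne_zero : ∀ e ∈ carrier, (e : S) ≠ 0
  mul_mem : ∀ e ∈ carrier, ∀ f ∈ carrier, e * f ∈ carrier
  mem_of_le : ∀ e ∈ carrier, ∀ f, e ≤ f → f ∈ carrier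

instance : Membership (Idem S) (IdemFilter S) := ⟨fun ξ e => e ∈ ξ.carrier⟩

theorem IdemFilter.ext_mem {ξ η : IdemFilter S} (h : ∀ e, e ∈ ξ ↔ e ∈ η) : ξ = η :=
  IdemFilter.ext (Set.ext h)

theorem IdemFilter.mul_mem_iff (ξ : IdemFilter S) (e f : Idem S) :
    e * f ∈ ξ ↔ e ∈ ξ ∧ f ∈ ξ :=
  ⟨fun h => ⟨ξ.mem_of_le _ h _ (Idem.mul_le_left e f), ξ.mem_of_le _ h _ (Idem.mul_le_right e f)⟩,
    fun h => ξ.mul_mem _ h.1 _ h.2⟩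

theorem IdemFilter.one_mem (ξ : IdemFilter S) : (1 : Idem S) ∈ ξ := by
  obtain ⟨e, he⟩ := ξ.nonempty
  exact ξ.mem_of_le e he 1 (Idem.le_one e)

/-- The set `U(X, Y)` of filters containing `X` and disjoint from `Y`. -/
def basicSet (X Y : Finset (Idem S)) : Set (IdemFilter S) :=
  {ξ | (∀ e ∈ X, e ∈ ξ) ∧ ∀ e ∈ Y, e ∉ ξ}

/-- The topology of the spectrum, generated by the sets `U(X, Y)` with `X`, `Y` finite; it is the
subspace topology of the product `{0,1}^{E(S)}`. -/
instance : TopologicalSpace (IdemFilter S) :=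
  TopologicalSpace.generateFrom {V | ∃ X Y : Finset (Idem S), V = basicSet X Y}

/-- An ultrafilter is a filter not properly contained in any other filter. -/
def IsUltra (ξ : IdemFilter S) : Prop :=
  ∀ η : IdemFilter S, ξ.carrier ⊆ η.carrier → η = ξ

variable (S) in
/-- The tight spectrum: the closure of the set of ultrafilters in the space of filters. -/
def TightSpectrum : Type u := ↥(closure {ξ : IdemFilter S | IsUltra ξ})

instance : TopologicalSpace (TightSpectrum S) :=
  inferInstanceAs (TopologicalSpace ↥(closure {ξ : IdemFilter S | IsUltra ξ}))

instance : MeasurableSpace (TightSpectrum S) := borel _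

instance : BorelSpace (TightSpectrum S) := ⟨rfl⟩

/-- The set `D_e` of tight filters containing the idempotent `e`. -/
def D (e : Idem S) : Set (TightSpectrum S) := {ξ | e ∈ ξ.1}

theorem conj_le_iff (s : S) (ξ : IdemFilter S) (hs : dom s ∈ ξ) (f : Idem S) :
    (∃ e ∈ ξ, conj s e ≤ f) ↔ conj s⁻¹ f ∈ ξ := by
  constructor
  · rintro ⟨e, he, hle⟩
    rw [Idem.le_iff] at hle
    refine ξ.mem_of_le _ (ξ.mul_mem _ he _ hs) _ ?_
    rw [Idem.le_iff]
    simp only [conj, dom, Idem.coe_mul, inv_inv'] at hle ⊢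
    rw [idem_comm e.2 (idem_inv_mul s)]
    calc s⁻¹ * f * s * (s⁻¹ * s * e) = s⁻¹ * f * (s * s⁻¹ * s * e) := by simp only [mul_assoc]
      _ = s⁻¹ * f * (s * e * s⁻¹ * s) := by rw [mul_inv_mul, mul_idem_inv_mul s e.2]
      _ = s⁻¹ * (f * (s * e * s⁻¹)) * s := by simp only [mul_assoc]
      _ = s⁻¹ * (s * e * s⁻¹ * s) := by rw [hle]; simp only [mul_assoc]
      _ = s⁻¹ * s * e := by rw [mul_idem_inv_mul s e.2, mul_assoc]
  · intro h
    refine ⟨_, h, ?_⟩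
    rw [Idem.le_iff]
    simp only [conj, inv_inv']
    have hc := idem_comm f.2 (idem_mul_inv s)
    calc (f : S) * (s * (s⁻¹ * f * s) * s⁻¹) = f * (s * s⁻¹ * f) * (s * s⁻¹) := by
          simp only [mul_assoc]
      _ = f * (f * (s * s⁻¹)) * (s * s⁻¹) := by rw [hc]
      _ = f * (s * s⁻¹) * (s * s⁻¹) := by rw [← mul_assoc (f : S) (f : S), f.2.eq]
      _ = s * (s⁻¹ * f * s) * s⁻¹ := by rw [hc]; simp only [mul_assoc]

/-- The filter `{s e s⁻¹ | e ∈ ξ}^↑` (upward closure in `E(S)`), for `s⁻¹ s ∈ ξ`. -/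
def actFilter (s : S) (ξ : IdemFilter S) (hs : dom s ∈ ξ) : IdemFilter S where
  carrier := {f | ∃ e ∈ ξ, conj s e ≤ f}
  nonempty := ⟨_, _, hs, le_rfl⟩
  ne_zero f hf h0 := by
    have h := (conj_le_iff s ξ hs f).1 hf
    exact ξ.ne_zero _ h (by simp [conj, h0])
  mul_mem e he f hf := by
    have h1 := (conj_le_iff s ξ hs e).1 he
    have h2 := (conj_le_iff s ξ hs f).1 hf
    refine (conj_le_iff s ξ hs _).2 ?_
    have : conj s⁻¹ (e * f) = conj s⁻¹ e * conj s⁻¹ f := by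
      apply Subtype.ext
      simp only [conj, Idem.coe_mul, inv_inv']
      have := mul_idem_inv_mul s⁻¹ e.2
      rw [inv_inv'] at this
      calc s⁻¹ * (e * f) * s = (s⁻¹ * e) * f * s := by simp only [mul_assoc]
        _ = (s⁻¹ * e * s * s⁻¹) * f * s := by rw [this]
        _ = s⁻¹ * e * s * (s⁻¹ * f * s) := by simp only [mul_assoc]
    rw [this]
    exact ξ.mul_mem _ h1 _ h2
  mem_of_le e he f hef := by
    obtain ⟨g, hg, hge⟩ := he
    exact ⟨g, hg, hge.trans hef⟩

theorem mem_actFilter (s : S) (ξ : IdemFilter S) (hs : dom s ∈ ξ) (f : Idem S) :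
    f ∈ actFilter s ξ hs ↔ conj s⁻¹ f ∈ ξ := conj_le_iff s ξ hs f

theorem conj_mem_actFilter (s : S) (ξ : IdemFilter S) (hs : dom s ∈ ξ) {e : Idem S}
    (he : e ∈ ξ) : conj s e ∈ actFilter s ξ hs := ⟨e, he, le_rfl⟩

theorem conj_conj (s t : S) (e : Idem S) : conj s (conj t e) = conj (s * t) e := by
  apply Subtype.ext
  simp only [conj, mul_inv_rev', mul_assoc]

theorem conj_idem (g e : Idem S) : conj (g : S) e = g * e := by
  apply Subtype.ext
  simp only [conj, Idem.coe_mul]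
  rw [inv_of_idem g.2, mul_assoc, idem_comm e.2 g.2, ← mul_assoc, g.2.eq]

theorem dom_inv_mem (s : S) (ξ : IdemFilter S) (hs : dom s ∈ ξ) :
    dom s⁻¹ ∈ actFilter s ξ hs := by
  have h := conj_mem_actFilter s ξ hs hs
  have : conj s (dom s) = dom s⁻¹ := by
    apply Subtype.ext
    simp only [conj, dom, inv_inv', ← mul_assoc, mul_inv_mul]
  rwa [this] at h

theorem actFilter_inv (s : S) (ξ : IdemFilter S) (hs : dom s ∈ ξ)
    (h : dom s⁻¹ ∈ actFilter s ξ hs) : actFilter s⁻¹ (actFilter s ξ hs) h = ξ := by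
  apply IdemFilter.ext_mem
  intro e
  rw [mem_actFilter, mem_actFilter, conj_conj, inv_inv']
  change conj (dom s : S) e ∈ ξ ↔ _
  rw [conj_idem, IdemFilter.mul_mem_iff]
  exact ⟨fun h => h.2, fun h => ⟨hs, h⟩⟩

theorem actFilter_congr {s t : S} {ξ η : IdemFilter S} (hst : s = t) (h : ξ = η)
    (hs : dom s ∈ ξ) (ht : dom t ∈ η) : actFilter s ξ hs = actFilter t η ht := by
  subst hst; subst h; rfl

theorem isUltra_actFilter (s : S) (ξ : IdemFilter S) (hs : dom s ∈ ξ) (hξ : IsUltra ξ) :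
    IsUltra (actFilter s ξ hs) := by
  intro ζ hζ
  have h1 : dom s⁻¹ ∈ ζ := hζ (dom_inv_mem s ξ hs)
  have h2 : actFilter s⁻¹ ζ h1 = ξ := by
    apply hξ
    intro e he
    refine (mem_actFilter _ _ _ _).2 (hζ ?_)
    rw [inv_inv']
    exact conj_mem_actFilter s ξ hs he
  have h3 := actFilter_inv s⁻¹ ζ h1 (dom_inv_mem _ _ _)
  rw [← h3]
  exact actFilter_congr (inv_inv' s) h2 _ _

theorem isOpen_basicSet (X Y : Finset (Idem S)) : IsOpen (basicSet X Y) :=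
  TopologicalSpace.isOpen_generateFrom_of_mem ⟨X, Y, rfl⟩

theorem basicSet_isBasis : TopologicalSpace.IsTopologicalBasis
    {V : Set (IdemFilter S) | ∃ X Y : Finset (Idem S), V = basicSet X Y} := by
  classical
  refine ⟨?_, ?_, rfl⟩
  · rintro _ ⟨X, Y, rfl⟩ _ ⟨X', Y', rfl⟩ ξ ⟨h, h'⟩
    refine ⟨_, ⟨X ∪ X', Y ∪ Y', rfl⟩, ?_, ?_⟩
    · simp only [basicSet, Set.mem_ofPred_eq, Finset.mem_union] at h h' ⊢
      exact ⟨fun e he => he.elim (h.1 e) (h'.1 e), fun e he => he.elim (h.2 e) (h'.2 e)⟩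
    · intro η hη
      simp only [basicSet, Set.mem_ofPred_eq, Finset.mem_union, Set.mem_inter_iff] at hη ⊢
      exact ⟨⟨fun e he => hη.1 e (Or.inl he), fun e he => hη.2 e (Or.inl he)⟩,
        ⟨fun e he => hη.1 e (Or.inr he), fun e he => hη.2 e (Or.inr he)⟩⟩
  · refine Set.eq_univ_of_univ_subset fun ξ _ => ⟨_, ⟨∅, ∅, rfl⟩, ?_⟩
    simp [basicSet]

theorem actFilter_mem_closure (s : S) (ξ : IdemFilter S) (hs : dom s ∈ ξ)
    (hξ : ξ ∈ closure {ξ : IdemFilter S | IsUltra ξ}) :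
    actFilter s ξ hs ∈ closure {ξ : IdemFilter S | IsUltra ξ} := by
  classical
  rw [basicSet_isBasis.mem_closure_iff]
  rintro _ ⟨X, Y, rfl⟩ ⟨hX, hY⟩
  obtain ⟨η, ⟨hη1, hη2⟩, hη⟩ := mem_closure_iff.1 hξ _
    (isOpen_basicSet (insert (dom s) (X.image (conj s⁻¹))) (Y.image (conj s⁻¹)))
    ⟨by
      intro e he
      rcases Finset.mem_insert.1 he with rfl | he
      · exact hs
      · obtain ⟨f, hf, rfl⟩ := Finset.mem_image.1 he
        exact (mem_actFilter _ _ _ _).1 (hX f hf),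
     by
      intro e he
      obtain ⟨f, hf, rfl⟩ := Finset.mem_image.1 he
      exact fun h => hY f hf ((mem_actFilter _ _ _ _).2 h)⟩
  have hsη : dom s ∈ η := hη1 _ (Finset.mem_insert_self _ _)
  refine ⟨actFilter s η hsη, ⟨?_, ?_⟩, isUltra_actFilter s η hsη hη⟩
  · intro f hf
    exact (mem_actFilter _ _ _ _).2
      (hη1 _ (Finset.mem_insert_of_mem (Finset.mem_image_of_mem _ hf)))
  · intro f hf h
    exact hη2 _ (Finset.mem_image_of_mem _ hf) ((mem_actFilter _ _ _ _).1 h)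

/-- The standard action on the tight spectrum: `θ_s : D_{s⁻¹ s} → D_{s s⁻¹}`,
`θ_s(ξ) = {s e s⁻¹ | e ∈ ξ}^↑`. -/
def theta (s : S) (x : TightSpectrum S) (hx : x ∈ D (dom s)) : TightSpectrum S :=
  ⟨actFilter s x.1 hx, actFilter_mem_closure s x.1 hx x.2⟩

theorem mem_D_theta (s : S) (x : TightSpectrum S) (hx : x ∈ D (dom s)) (f : Idem S) :
    theta s x hx ∈ D f ↔ x ∈ D (conj s⁻¹ f) := mem_actFilter s x.1 hx f

theorem theta_ext {x y : TightSpectrum S} (h : ∀ e, x ∈ D e ↔ y ∈ D e) : x = y :=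
  Subtype.ext (IdemFilter.ext_mem h)

theorem mem_D_mul (x : TightSpectrum S) (e f : Idem S) :
    x ∈ D (e * f) ↔ x ∈ D e ∧ x ∈ D f := IdemFilter.mul_mem_iff x.1 e f

theorem dom_mul (t s : S) : dom (t * s) = conj s⁻¹ (dom t) := by
  apply Subtype.ext
  simp only [dom, conj, mul_inv_rev', inv_inv', mul_assoc]

theorem mem_D_dom_mul (t s : S) (x : TightSpectrum S) (hs : x ∈ D (dom s))
    (ht : theta s x hs ∈ D (dom t)) : x ∈ D (dom (t * s)) := by
  rw [dom_mul]; exact (mem_D_theta _ _ _ _).1 ht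

theorem theta_mul (t s : S) (x : TightSpectrum S) (hs : x ∈ D (dom s))
    (ht : theta s x hs ∈ D (dom t)) (hts : x ∈ D (dom (t * s))) :
    theta (t * s) x hts = theta t (theta s x hs) ht := by
  apply theta_ext
  intro f
  rw [mem_D_theta, mem_D_theta, mem_D_theta, conj_conj, mul_inv_rev']

theorem theta_idem (g : Idem S) (x : TightSpectrum S) (hx : x ∈ D (dom (g : S)))
    (hg : x ∈ D g) : theta (g : S) x hx = x := by
  apply theta_ext
  intro f
  rw [mem_D_theta, inv_of_idem g.2, conj_idem, mem_D_mul]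
  exact ⟨fun h => h.2, fun h => ⟨hg, h⟩⟩

theorem mem_D_dom_inv (s : S) (x : TightSpectrum S) (hx : x ∈ D (dom s)) :
    theta s x hx ∈ D (dom s⁻¹) := dom_inv_mem s x.1 hx

theorem theta_inv (s : S) (x : TightSpectrum S) (hx : x ∈ D (dom s))
    (h : theta s x hx ∈ D (dom s⁻¹)) : theta s⁻¹ (theta s x hx) h = x :=
  Subtype.ext (actFilter_inv s x.1 hx h)

variable (S) in
/-- The pairs `(s, x)` with `x ∈ D_{s⁻¹ s}`. -/
def GermPair : Type u := {p : S × TightSpectrum S // p.2 ∈ D (dom p.1)}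

/-- `(s, x) ~ (t, y)` iff `x = y` and `s e = t e` for some idempotent `e` with `x ∈ D_e`. -/
def germRel (p q : GermPair S) : Prop :=
  p.1.2 = q.1.2 ∧ ∃ e : Idem S, p.1.1 * (e : S) = q.1.1 * (e : S) ∧ p.1.2 ∈ D e

instance germSetoid : Setoid (GermPair S) where
  r := germRel
  iseqv :=
    { refl := fun p => ⟨rfl, dom p.1.1, rfl, p.2⟩
      symm := by
        rintro p q ⟨h, e, he, hx⟩
        exact ⟨h.symm, e, he.symm, h ▸ hx⟩
      trans := by
        rintro p q v ⟨h, e, he, hx⟩ ⟨h', f, hf, hy⟩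
        refine ⟨h.trans h', e * f, ?_, (mem_D_mul _ _ _).2 ⟨hx, h ▸ hy⟩⟩
        rw [Idem.coe_mul, ← mul_assoc, he, idem_comm e.2 f.2, mul_assoc, ← idem_comm e.2 f.2,
          idem_comm e.2 f.2, ← mul_assoc, hf, mul_assoc] }

variable (S) in
/-- The germs `[s, x]` of the standard action: the arrows of the tight groupoid. -/
def Germ : Type u := Quotient (germSetoid (S := S))

/-- The germ `[s, x]`. -/
def germ (s : S) (x : TightSpectrum S) (hx : x ∈ D (dom s)) : Germ S :=
  Quotient.mk _ ⟨(s, x), hx⟩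

theorem germ_eq {s t : S} {x y : TightSpectrum S} (hx : x ∈ D (dom s)) (hy : y ∈ D (dom t)) :
    germ s x hx = germ t y hy ↔ x = y ∧ ∃ e : Idem S, s * (e : S) = t * (e : S) ∧ x ∈ D e :=
  ⟨fun h => Quotient.exact h, fun h => Quotient.sound h⟩

theorem germ_ind {P : Germ S → Prop} (h : ∀ s x hx, P (germ s x hx)) (γ : Germ S) : P γ := by
  induction γ using Quotient.ind with
  | _ p => exact h p.1.1 p.1.2 p.2

/-- If `s e = t e` then `e s⁻¹ f s e = e t⁻¹ f t e`. -/
theorem conj_eq_of_mul_eq {s t : S} {e : Idem S} (h : s * (e : S) = t * (e : S)) (f : Idem S) :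
    e * conj s⁻¹ f = e * conj t⁻¹ f := by
  have key : ∀ v : S, ((e * conj v⁻¹ f : Idem S) : S) = (v * (e : S))⁻¹ * f * (v * e) := by
    intro v
    have h1 : conj (e : S) (conj v⁻¹ f) = e * conj v⁻¹ f := conj_idem _ _
    rw [← h1, conj_conj]
    simp only [conj, mul_inv_rev', inv_inv', inv_of_idem e.2]
  apply Subtype.ext
  rw [key, key, h]

theorem theta_eq_of_mul_eq {s t : S} {x : TightSpectrum S} (hs : x ∈ D (dom s))
    (ht : x ∈ D (dom t)) {e : Idem S} (h : s * (e : S) = t * (e : S)) (he : x ∈ D e) :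
    theta s x hs = theta t x ht := by
  apply theta_ext
  intro f
  have h1 := mem_D_mul x e (conj s⁻¹ f)
  have h2 := mem_D_mul x e (conj t⁻¹ f)
  rw [conj_eq_of_mul_eq h f] at h1
  rw [mem_D_theta, mem_D_theta]
  tauto

/-- The source map `d([s, x]) = x`. -/
def Germ.d : Germ S → TightSpectrum S :=
  Quotient.lift (fun p : GermPair S => p.1.2) fun _ _ h => h.1

/-- The range map `r([s, x]) = θ_s(x)`. -/
def Germ.r : Germ S → TightSpectrum S :=
  Quotient.lift (fun p : GermPair S => theta p.1.1 p.1.2 p.2) (by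
    rintro ⟨⟨s, x⟩, hs⟩ ⟨⟨t, y⟩, ht⟩ ⟨h, e, he, hx⟩
    obtain rfl : x = y := h
    exact theta_eq_of_mul_eq hs ht he hx)

/-- The inverse `[s, x]⁻¹ = [s⁻¹, θ_s(x)]`. -/
def Germ.inv : Germ S → Germ S :=
  Quotient.lift (fun p : GermPair S =>
      germ p.1.1⁻¹ (theta p.1.1 p.1.2 p.2) (mem_D_dom_inv _ _ _)) (by
    rintro ⟨⟨s, x⟩, hs⟩ ⟨⟨t, y⟩, ht⟩ ⟨h, e, he, hx⟩
    obtain rfl : x = y := h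
    change s * (e : S) = t * (e : S) at he
    refine (germ_eq _ _).2 ⟨theta_eq_of_mul_eq hs ht he hx, conj s e, ?_,
      conj_mem_actFilter s x.1 hs hx⟩
    have key : ∀ v : S, v⁻¹ * (v * (e : S) * v⁻¹) = (v * (e : S))⁻¹ := by
      intro v
      rw [mul_inv_rev', inv_of_idem e.2]
      calc v⁻¹ * (v * (e : S) * v⁻¹) = (v⁻¹ * v) * e * v⁻¹ := by simp only [mul_assoc]
        _ = e * (v⁻¹ * v * v⁻¹) := by
          rw [idem_comm (idem_inv_mul v) e.2]; simp only [mul_assoc]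
        _ = e * v⁻¹ := by rw [inv_mul_inv]
    have h2 : s * (e : S) * s⁻¹ = t * e * t⁻¹ := by
      have : ∀ v : S, v * (e : S) * v⁻¹ = (v * e) * (v * (e : S))⁻¹ := by
        intro v
        rw [mul_inv_rev', inv_of_idem e.2, ← mul_assoc, mul_assoc v (e : S) (e : S), e.2.eq]
      rw [this, this, he]
    change s⁻¹ * (s * (e : S) * s⁻¹) = t⁻¹ * (s * (e : S) * s⁻¹)
    rw [key, h2, key, he])

theorem Germ.d_germ (s : S) (x : TightSpectrum S) (hx) : (germ s x hx).d = x := rfl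

theorem Germ.r_germ (s : S) (x : TightSpectrum S) (hx) : (germ s x hx).r = theta s x hx := rfl

theorem Germ.inv_germ (s : S) (x : TightSpectrum S) (hx) :
    (germ s x hx).inv = germ s⁻¹ (theta s x hx) (mem_D_dom_inv s x hx) := rfl

theorem germ_mul_congr {t t' s s' : S} {x : TightSpectrum S} (hs : x ∈ D (dom s))
    {e f : Idem S} (he : s * (e : S) = s' * (e : S)) (hxe : x ∈ D e)
    (hf : t * (f : S) = t' * (f : S)) (hxf : theta s x hs ∈ D f) :
    ∃ g : Idem S, t * s * (g : S) = t' * s' * (g : S) ∧ x ∈ D g := by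
  refine ⟨e * conj s⁻¹ f, ?_, (mem_D_mul _ _ _).2 ⟨hxe, (mem_D_theta _ _ _ _).1 hxf⟩⟩
  have h1 : ∀ v : S, v * (s * ((e * conj s⁻¹ f : Idem S) : S)) = v * f * (s * e) := by
    intro v
    simp only [Idem.coe_mul]
    rw [idem_comm e.2 (conj s⁻¹ f).2]
    simp only [conj, inv_inv']
    calc v * (s * (s⁻¹ * f * s * (e : S))) = v * ((s * s⁻¹) * f) * (s * e) := by
          simp only [mul_assoc]
      _ = v * f * (s * s⁻¹ * s * e) := by
          rw [idem_comm (idem_mul_inv s) f.2]; simp only [mul_assoc]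
      _ = v * f * (s * e) := by rw [mul_inv_mul]
  have h2 : s' * ((e * conj s⁻¹ f : Idem S) : S) = s * ((e * conj s⁻¹ f : Idem S) : S) := by
    simp only [Idem.coe_mul]
    rw [← mul_assoc, ← he, mul_assoc]
  rw [mul_assoc t', h2, mul_assoc t, h1, h1, hf]

/-- The product of a composable pair of germs, `[t, θ_s(x)] [s, x] = [t s, x]`, computed on
representatives; see `Germ.comp_germ`. -/
noncomputable def Germ.comp (γ η : Germ S) (h : γ.d = η.r) : Germ S :=
  germ (γ.out.1.1 * η.out.1.1) η.out.1.2 (by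
    refine mem_D_dom_mul _ _ _ η.out.2 ?_
    have h1 : γ.d = γ.out.1.2 := (congrArg Germ.d (Quotient.out_eq γ)).symm
    have h2 : η.r = theta η.out.1.1 η.out.1.2 η.out.2 :=
      (congrArg Germ.r (Quotient.out_eq η)).symm
    rw [← h2, ← h, h1]
    exact γ.out.2)

theorem Germ.comp_germ (t s : S) (x : TightSpectrum S) (hs : x ∈ D (dom s))
    (ht : theta s x hs ∈ D (dom t)) :
    (germ t (theta s x hs) ht).comp (germ s x hs) rfl =
      germ (t * s) x (mem_D_dom_mul t s x hs ht) := by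
  obtain ⟨h1, f, hf, hf'⟩ := Quotient.exact (Quotient.out_eq (germ t (theta s x hs) ht))
  obtain ⟨h2, e, he, he'⟩ := Quotient.exact (Quotient.out_eq (germ s x hs))
  unfold Germ.comp
  change (germ t (theta s x hs) ht).out.1.2 = theta s x hs at h1
  change (germ s x hs).out.1.2 = x at h2
  rw [h1] at hf'
  rw [h2] at he'
  refine (germ_eq _ _).2 ⟨h2, ?_⟩
  obtain ⟨g, hg, hg'⟩ := germ_mul_congr hs he.symm he' hf.symm hf'
  exact ⟨g, hg.symm, by rw [h2]; exact hg'⟩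

theorem Germ.comp_eq {t s : S} {y x : TightSpectrum S} (ht : y ∈ D (dom t)) (hs : x ∈ D (dom s))
    (h : y = theta s x hs) :
    (germ t y ht).comp (germ s x hs) h =
      germ (t * s) x (mem_D_dom_mul t s x hs (h ▸ ht)) := by
  subst h
  exact Germ.comp_germ t s x hs ht

theorem mem_D_dom_one (x : TightSpectrum S) : x ∈ D (dom (1 : S)) := by
  have : dom (1 : S) = 1 := by
    apply Subtype.ext
    simp [dom, inv_of_idem (IsIdempotentElem.one (M := S))]
  rw [this]
  exact x.1.one_mem

/-- The unit germ at `x`. -/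
def Germ.unit (x : TightSpectrum S) : Germ S := germ 1 x (mem_D_dom_one x)

theorem theta_one (x : TightSpectrum S) : theta (1 : S) x (mem_D_dom_one x) = x :=
  theta_idem (1 : Idem S) x (mem_D_dom_one x) x.1.one_mem

theorem Germ.d_comp (γ η : Germ S) (h : γ.d = η.r) : (γ.comp η h).d = η.d := by
  induction γ using germ_ind with | _ t y ht
  induction η using germ_ind with | _ s x hs
  rw [Germ.comp_eq ht hs h]; rfl

theorem Germ.r_comp (γ η : Germ S) (h : γ.d = η.r) : (γ.comp η h).r = γ.r := by
  induction γ using germ_ind with | _ t y ht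
  induction η using germ_ind with | _ s x hs
  obtain rfl : y = theta s x hs := h
  rw [Germ.comp_eq ht hs rfl]
  exact theta_mul t s x hs ht _

theorem Germ.comp_unit (γ : Germ S) (h) : γ.comp (Germ.unit γ.d) h = γ := by
  induction γ using germ_ind with | _ t y ht
  exact (Germ.comp_eq ht (mem_D_dom_one y) h).trans
    ((germ_eq _ _).2 ⟨rfl, 1, by simp, y.1.one_mem⟩)

theorem Germ.unit_comp (γ : Germ S) (h) : (Germ.unit γ.r).comp γ h = γ := by
  induction γ using germ_ind with | _ t y ht
  exact (Germ.comp_eq (mem_D_dom_one (theta t y ht)) ht h).trans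
    ((germ_eq _ _).2 ⟨rfl, 1, by simp, y.1.one_mem⟩)

theorem Germ.comp_assoc (γ η ζ : Germ S) (h₁ : γ.d = η.r) (h₂ : η.d = ζ.r) (h₃ h₄) :
    (γ.comp η h₁).comp ζ h₃ = γ.comp (η.comp ζ h₂) h₄ := by
  induction γ using germ_ind with | _ v z hv
  induction η using germ_ind with | _ t y ht
  induction ζ using germ_ind with | _ s x hs
  obtain rfl : y = theta s x hs := h₂
  obtain rfl : z = theta t (theta s x hs) ht := h₁
  have e1 := Germ.comp_eq hv ht rfl
  have e2 := Germ.comp_eq ht hs rfl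
  have hz : theta t (theta s x hs) ht = theta (t * s) x (mem_D_dom_mul t s x hs ht) :=
    (theta_mul t s x hs ht _).symm
  have l := Germ.comp_eq (mem_D_dom_mul v t (theta s x hs) ht hv) hs rfl
  have m := Germ.comp_eq hv (mem_D_dom_mul t s x hs ht) hz
  simp only [e1, e2, l, m]
  exact (germ_eq _ _).2 ⟨rfl, 1, by simp [mul_assoc], x.1.one_mem⟩

theorem Germ.d_inv (γ : Germ S) : γ.inv.d = γ.r := by
  induction γ using germ_ind with | _ s x hs
  rfl

theorem Germ.r_inv (γ : Germ S) : γ.inv.r = γ.d := by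
  induction γ using germ_ind with | _ s x hs
  exact theta_inv s x hs _

theorem Germ.inv_comp (γ : Germ S) (h) : γ.inv.comp γ h = Germ.unit γ.d := by
  induction γ using germ_ind with | _ s x hs
  refine (Germ.comp_eq (mem_D_dom_inv s x hs) hs rfl).trans ((germ_eq _ _).2 ⟨rfl, dom s, ?_, hs⟩)
  simp only [dom]
  rw [one_mul, (idem_inv_mul s).eq]

theorem Germ.comp_inv (γ : Germ S) (h) : γ.comp γ.inv h = Germ.unit γ.r := by
  induction γ using germ_ind with | _ s x hs
  refine (Germ.comp_eq hs (mem_D_dom_inv s x hs) h).trans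
    ((germ_eq _ _).2 ⟨rfl, dom s⁻¹, ?_, mem_D_dom_inv s x hs⟩)
  simp only [dom, inv_inv']
  rw [one_mul, (idem_mul_inv s).eq]

/-- The tight groupoid: the groupoid of germs of the standard action, with unit (object) space
the tight spectrum and with the germs `γ` such that `d(γ) = x`, `r(γ) = y` as arrows `x ⟶ y`. -/
noncomputable instance tightGroupoid : CategoryTheory.Groupoid.{u} (TightSpectrum S) where
  Hom x y := {γ : Germ S // γ.d = x ∧ γ.r = y}
  id x := ⟨Germ.unit x, rfl, theta_one x⟩
  comp η γ := ⟨γ.1.comp η.1 (γ.2.1.trans η.2.2.symm),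
    (Germ.d_comp _ _ _).trans η.2.1, (Germ.r_comp _ _ _).trans γ.2.2⟩
  inv γ := ⟨γ.1.inv, (Germ.d_inv _).trans γ.2.2, (Germ.r_inv _).trans γ.2.1⟩
  id_comp := by
    rintro x y ⟨γ, rfl, rfl⟩
    exact Subtype.ext (Germ.comp_unit γ (theta_one _).symm)
  comp_id := by
    rintro x y ⟨γ, rfl, rfl⟩
    exact Subtype.ext (Germ.unit_comp γ rfl)
  assoc := by
    rintro x y z w ⟨γ, h1, h2⟩ ⟨η, h3, h4⟩ ⟨ζ, h5, h6⟩
    exact Subtype.ext (Germ.comp_assoc ζ η γ (h5.trans h4.symm) (h3.trans h2.symm)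
      ((Germ.d_comp _ _ _).trans (h3.trans h2.symm))
      ((h5.trans h4.symm).trans (Germ.r_comp _ _ _).symm)).symm
  inv_comp := by
    rintro x y ⟨γ, rfl, rfl⟩
    exact Subtype.ext (Germ.comp_inv γ (Germ.r_inv γ).symm)
  comp_inv := by
    rintro x y ⟨γ, rfl, rfl⟩
    exact Subtype.ext (Germ.inv_comp γ (Germ.d_inv γ))

/-- The set `Θ(s, U) = {[s, x] | x ∈ U}` of arrows, for `U ⊆ D_{s⁻¹ s}`. -/
def Theta (s : S) (U : Set (TightSpectrum S)) (hU : U ⊆ D (dom s)) :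
    Set (CategoryTheory.Arrow (TightSpectrum S)) :=
  {γ | ∃ (x : TightSpectrum S) (hx : x ∈ U), γ.hom.1 = germ s x (hU hx)}

/-- The topology on the arrows of the tight groupoid, generated by the sets `Θ(s, U)` with
`U ⊆ D_{s⁻¹ s}` open. -/
instance arrowTopology : TopologicalSpace (CategoryTheory.Arrow (TightSpectrum S)) :=
  TopologicalSpace.generateFrom
    {V | ∃ (s : S) (U : Set (TightSpectrum S)) (hU : U ⊆ D (dom s)), IsOpen U ∧ V = Theta s U hU}

end Spectrum

section InvariantMeasures

variable {X : Type u} [CategoryTheory.Groupoid.{u} X]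

/-- A bisection of a groupoid with topologized arrow space: an open set of arrows on which both
the range map and the source map are injective. -/
def IsBisection [TopologicalSpace (CategoryTheory.Arrow X)]
    (U : Set (CategoryTheory.Arrow X)) : Prop :=
  IsOpen U ∧ Set.InjOn (fun γ : CategoryTheory.Arrow X => γ.right) U ∧
    Set.InjOn (fun γ : CategoryTheory.Arrow X => γ.left) U

variable (X) in
/-- `IM(𝒢)`: the invariant regular Borel probability measures on the unit space `X` of a groupoid;
here `left` is the source and `right` the range of an arrow. -/
def IM [TopologicalSpace X] [MeasurableSpace X] [BorelSpace X]
    [TopologicalSpace (CategoryTheory.Arrow X)] : Set (MeasureTheory.Measure X) :=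
  {ν | MeasureTheory.IsProbabilityMeasure ν ∧ ν.Regular ∧
    ∀ U : Set (CategoryTheory.Arrow X), IsBisection U →
      ν ((fun γ : CategoryTheory.Arrow X => γ.right) '' U) =
        ν ((fun γ : CategoryTheory.Arrow X => γ.left) '' U)}

end InvariantMeasures

section InvariantMeans

variable (S : Type u) [BooleanInverseMonoid S]

variable {S} in
/-- An invariant mean on a Boolean inverse monoid. -/
structure IsInvariantMean (μ : Idem S → ℝ≥0) : Prop where
  ne_zero : μ ≠ 0
  invariant : ∀ s : S, μ (dom s) = μ (ran s)
  additive : ∀ e f g : Idem S, (e : S) * (f : S) = 0 → IsLUB {(e : S), (f : S)} (g : S) →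
    μ g = μ e + μ f

/-- `M(S)`: the normalized invariant means. -/
def NormalizedInvariantMeans : Set (Idem S → ℝ≥0) := {μ | IsInvariantMean μ ∧ μ 1 = 1}

variable {S} in
/-- The set of idempotents fixed by `s`. -/
def fixedIdem (s : S) : Set (Idem S) := {e | s * (e : S) = e}

variable {S} in
/-- `C ⊆ Y` is a cover of `Y` if every nonzero element of `Y` meets some element of `C`. -/
def IsCover (C Y : Set (Idem S)) : Prop :=
  C ⊆ Y ∧ ∀ y ∈ Y, (y : S) ≠ 0 → ∃ c ∈ C, (c : S) * (y : S) ≠ 0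

/-- Condition (H): for every `s`, the set of idempotents fixed by `s` has a finite cover. -/
def ConditionH : Prop := ∀ s : S, ∃ C : Set (Idem S), C.Finite ∧ IsCover C (fixedIdem s)

variable {S} in
/-- `η_ν(e) = ν(D_e)`. For a probability measure `ν` the value `ν(D_e)` is finite, so that
`ENNReal.toNNReal` loses nothing. -/
noncomputable def eta (ν : MeasureTheory.Measure (TightSpectrum S)) (e : Idem S) : ℝ≥0 :=
  (ν (D e)).toNNReal

end InvariantMeans

end InverseMonoids

open InverseMonoids

/-! The map `e ↦ D e` is an isomorphism from the Boolean algebra `E(S)` onto a Boolean algebra of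
clopen sets that forms a basis of the compact Hausdorff tight spectrum (`D_mul`, `D_isLUB`,
`D_injective`, `isTopologicalBasis_range_D`). A normalized additive function on `E(S)` is therefore
the same as a finitely additive probability on these clopen sets. By compactness such a content is
countably additive, so Carathéodory extends it to a Borel measure; the extension is unique because
the sets `D e` form a generating π-system.

What remains is to match the two notions of invariance (`mem_IM_iff`). The bisection `Theta s (D
(dom s))` has source `D (dom s)` and range `D (ran s)`, so an invariant measure gives an invariant
mean. Conversely, equality on these pairs, applied to all restrictions `s * e`, shows that each
`θ_s` preserves the measure of every Borel set. Since `S` is countable, any bisection splits into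
countably many measurable pieces on each of which range and source are related by a single `θ_s`,
and the measures add up. -/

namespace InverseMonoids

universe u

open InverseMonoidWithZero Set Topology

/-! ### Idempotents and ultrafilters in `E(S)`. -/

section Idempotents

variable {S : Type u} [InverseMonoidWithZero S]

theorem zero_le_of_inverseMonoid (s : S) : (0 : S) ≤ s := by
  rw [le_def, mul_zero]

theorem isIdempotentElem_of_le_one {s : S} (h : s ≤ 1) : IsIdempotentElem s := by
  rw [le_def, one_mul] at h
  rw [← h]
  exact idem_inv_mul s

instance : Zero (Idem S) := ⟨⟨0, IsIdempotentElem.zero⟩⟩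

@[simp] theorem Idem.coe_zero : ((0 : Idem S) : S) = 0 := rfl

theorem Idem.coe_le_one (e : Idem S) : (e : S) ≤ 1 := e.le_one

theorem Idem.mul_comm (e f : Idem S) : e * f = f * e :=
  Subtype.ext (idem_comm e.2 f.2)

theorem compatible_of_idem {e f : S} (he : IsIdempotentElem e) (hf : IsIdempotentElem f) :
    Compatible e f := by
  rw [Compatible, inv_of_idem he, inv_of_idem hf]
  exact ⟨idem_mul he hf, idem_mul he hf⟩

/-- With `ran_mul_idem`, this lets an invariance hypothesis for single elements be applied to the
restriction of `s` to `e`: it then compares `e` with `conj s e`. -/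
theorem dom_mul_idem (s : S) {e : Idem S} (he : e ≤ dom s) : dom (s * (e : S)) = e := by
  rw [dom_mul, inv_of_idem e.2, conj_idem, Idem.mul_comm]
  exact Subtype.ext ((Idem.le_iff _ _).1 he)

theorem ran_mul_idem (s : S) (e : Idem S) : ran (s * (e : S)) = conj s e := by
  apply Subtype.ext
  simp only [ran, conj]
  rw [mul_inv_rev', inv_of_idem e.2, ← mul_assoc, mul_assoc s, e.2.eq]

theorem dom_inv (s : S) : dom s⁻¹ = ran s := by
  apply Subtype.ext
  simp only [dom, ran, inv_inv']

theorem conj_le_ran (s : S) (e : Idem S) : conj s e ≤ ran s := by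
  rw [Idem.le_iff]
  simp only [conj, ran, ← mul_assoc, mul_inv_mul]

/-- Every nonzero idempotent lies in an ultrafilter. -/
theorem exists_isUltra_mem {e : Idem S} (he : (e : S) ≠ 0) :
    ∃ ξ : IdemFilter S, IsUltra ξ ∧ e ∈ ξ := by
  -- The principal filter of `e`, from which Zorn's lemma on carriers starts.
  let η : IdemFilter S :=
    { carrier := {f | e ≤ f}
      nonempty := ⟨e, le_refl e⟩
      ne_zero := by
        intro f hf h0
        have h := (Idem.le_iff e f).1 hf
        rw [h0, zero_mul] at h
        exact he h.symm
      mul_mem := by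
        intro f hf g hg
        have hf' := (Idem.le_iff e f).1 hf
        have hg' := (Idem.le_iff e g).1 hg
        refine (Idem.le_iff e _).2 ?_
        rw [Idem.coe_mul, mul_assoc, hg', hf']
      mem_of_le := fun f hf g hfg => le_trans hf hfg }
  have hchain : ∀ c ⊆ range (IdemFilter.carrier (S := S)), IsChain (· ⊆ ·) c → c.Nonempty →
      ∃ ub ∈ range (IdemFilter.carrier (S := S)), ∀ s ∈ c, s ⊆ ub := by
    intro c hc hchain ⟨A, hA⟩
    refine ⟨⋃₀ c, ⟨⟨⋃₀ c, ?_, ?_, ?_, ?_⟩, rfl⟩, fun s hs => subset_sUnion_of_mem hs⟩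
    · obtain ⟨ζ, rfl⟩ := hc hA
      obtain ⟨f, hf⟩ := ζ.nonempty
      exact ⟨f, _, hA, hf⟩
    · rintro f ⟨B, hB, hf⟩
      obtain ⟨ζ, rfl⟩ := hc hB
      exact ζ.ne_zero f hf
    · rintro f ⟨B, hB, hf⟩ g ⟨B', hB', hg⟩
      obtain h | h := hchain.total hB hB'
      · obtain ⟨ζ, rfl⟩ := hc hB'
        exact ⟨_, hB', ζ.mul_mem f (h hf) g hg⟩
      · obtain ⟨ζ, rfl⟩ := hc hB
        exact ⟨_, hB, ζ.mul_mem f hf g (h hg)⟩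
    · rintro f ⟨B, hB, hf⟩ g hfg
      obtain ⟨ζ, rfl⟩ := hc hB
      exact ⟨_, hB, ζ.mem_of_le f hf g hfg⟩
  obtain ⟨m, hηm, hm⟩ := zorn_subset_nonempty _ hchain η.carrier ⟨η, rfl⟩
  obtain ⟨ξ, rfl⟩ := hm.prop
  refine ⟨ξ, fun ζ hζ => ?_, hηm (le_refl e)⟩
  exact IdemFilter.ext (Subset.antisymm (hm.le_of_ge ⟨ζ, rfl⟩ hζ) hζ)

/-- An idempotent meeting every element of an ultrafilter belongs to it. -/
theorem IsUltra.mem_of_forall_mul_ne_zero {ξ : IdemFilter S} (hξ : IsUltra ξ) {e : Idem S}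
    (h : ∀ f ∈ ξ, (f : S) * (e : S) ≠ 0) : e ∈ ξ := by
  -- The filter generated by `ξ` and `e`; the hypothesis keeps `0` out of it, so maximality forces
  -- it to be `ξ`.
  let η : IdemFilter S :=
    { carrier := {g | ∃ f ∈ ξ, f * e ≤ g}
      nonempty := ⟨_, 1, ξ.one_mem, le_rfl⟩
      ne_zero := by
        rintro g ⟨f, hf, hle⟩ h0
        have h1 := (Idem.le_iff _ _).1 hle
        rw [h0, zero_mul] at h1
        exact h f hf h1.symm
      mul_mem := by
        rintro g ⟨f, hf, hle⟩ g' ⟨f', hf', hle'⟩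
        refine ⟨f * f', ξ.mul_mem _ hf _ hf', ?_⟩
        have h1 : f * f' * e ≤ g := le_trans (by
          rw [Idem.mul_comm f f', Idem.le_iff]
          simp only [Idem.coe_mul]
          have hc := idem_comm (idem_mul f.2 e.2) f'.2
          rw [mul_assoc (f' : S), ← mul_assoc _ (f' : S), hc, mul_assoc (f' : S),
            (idem_mul f.2 e.2).eq]) hle
        have h2 : f * f' * e ≤ g' := le_trans (by
          rw [Idem.le_iff]
          simp only [Idem.coe_mul]
          have hc := idem_comm (idem_mul f'.2 e.2) f.2
          rw [mul_assoc (f : S), ← mul_assoc _ (f : S), hc, mul_assoc (f : S),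
            (idem_mul f'.2 e.2).eq]) hle'
        rw [Idem.le_iff] at h1 h2 ⊢
        rw [Idem.coe_mul g g', mul_assoc, h2, h1]
      mem_of_le := fun g ⟨f, hf, hle⟩ g' hg => ⟨f, hf, hle.trans hg⟩ }
  have hη : η = ξ := hξ η fun f hf => ⟨f, hf, Idem.mul_le_left f e⟩
  rw [← hη]
  exact ⟨1, ξ.one_mem, Idem.mul_le_right 1 e⟩

end Idempotents

/-! ### Compactness of the spectrum and the clopen sets `D e`. -/

section Topology

variable {S : Type u} [InverseMonoidWithZero S]

theorem isOpen_setOf_mem (e : Idem S) : IsOpen {ξ : IdemFilter S | e ∈ ξ} := by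
  have h := isOpen_basicSet {e} (∅ : Finset (Idem S))
  simpa [basicSet] using h

theorem isOpen_setOf_notMem (e : Idem S) : IsOpen {ξ : IdemFilter S | e ∉ ξ} := by
  have h := isOpen_basicSet (∅ : Finset (Idem S)) {e}
  simpa [basicSet] using h

/-- The space of filters in `E(S)` is compact. -/
instance : CompactSpace (IdemFilter S) := by
  constructor
  rw [isCompact_iff_ultrafilter_le_nhds']
  intro F _
  -- The limit of the ultrafilter `F` consists of the idempotents that belong to `F`-almost every
  -- filter.
  let ξ : IdemFilter S :=
    { carrier := {e | ∀ᶠ η : IdemFilter S in (F : Filter (IdemFilter S)), e ∈ η}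
      nonempty := ⟨1, Filter.Eventually.of_forall fun η => η.one_mem⟩
      ne_zero := fun e he => by
        obtain ⟨η, hη⟩ := he.exists
        exact η.ne_zero e hη
      mul_mem := fun e he f hf => (he.and hf).mono fun η h => η.mul_mem e h.1 f h.2
      mem_of_le := fun e he f hef => he.mono fun η h => η.mem_of_le e h f hef }
  refine ⟨ξ, mem_univ _, ?_⟩
  rw [TopologicalSpace.nhds_generateFrom]
  refine le_iInf₂ ?_
  rintro _ ⟨hξ, X, Y, rfl⟩
  obtain ⟨hX, hY⟩ := hξ
  rw [Filter.le_principal_iff]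
  have h1 : ∀ᶠ η : IdemFilter S in (F : Filter (IdemFilter S)), ∀ e ∈ X, e ∈ η :=
    (Filter.eventually_all_finset X).2 hX
  have h2 : ∀ᶠ η : IdemFilter S in (F : Filter (IdemFilter S)), ∀ e ∈ Y, e ∉ η :=
    (Filter.eventually_all_finset Y).2 fun e he => Ultrafilter.eventually_not.2 (hY e he)
  exact h1.and h2

instance : CompactSpace (TightSpectrum S) :=
  isCompact_iff_compactSpace.1 (isClosed_closure (X := IdemFilter S)).isCompact

theorem isOpen_D (e : Idem S) : IsOpen (D e) :=
  (isOpen_setOf_mem e).preimage continuous_subtype_val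

theorem isClosed_D (e : Idem S) : IsClosed (D e) :=
  ⟨(isOpen_setOf_notMem e).preimage continuous_subtype_val⟩

theorem measurableSet_D (e : Idem S) : MeasurableSet (D e) := (isOpen_D e).measurableSet

theorem D_mul (e f : Idem S) : D (e * f) = D e ∩ D f := by
  ext x
  exact mem_D_mul x e f

@[simp] theorem D_one : D (1 : Idem S) = univ := eq_univ_of_forall fun x => x.1.one_mem

/-- A nonzero idempotent lies in an ultrafilter, which is a point of the tight spectrum; a filter
never contains `0`. -/
theorem D_eq_empty {e : Idem S} : D e = ∅ ↔ (e : S) = 0 := by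
  constructor
  · intro h
    by_contra he
    obtain ⟨ξ, hξ, heξ⟩ := exists_isUltra_mem he
    have : (⟨ξ, subset_closure hξ⟩ : TightSpectrum S) ∈ D e := heξ
    rw [h] at this
    exact this
  · intro h
    exact eq_empty_of_forall_notMem fun x hx => x.1.ne_zero e hx h

theorem D_mono {e f : Idem S} (h : e ≤ f) : D e ⊆ D f := fun x hx => x.1.mem_of_le e hx f h

end Topology

/-! ### Stone duality between `E(S)` and the sets `D e`. -/

section Boolean

variable {S : Type u} [BooleanInverseMonoid S]

theorem isLUB_mul_pair {e f j : Idem S} (h : IsLUB {(e : S), (f : S)} (j : S)) (t : S) :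
    IsLUB {t * (e : S), t * (f : S)} (t * (j : S)) := by
  classical
  have := DistributiveInverseMonoid.mul_join ({(e : S), (f : S)} : Finset S) ?_ (j : S)
    (by simpa using h) t
  · simpa [image_pair] using this
  · intro a ha b hb
    apply compatible_of_idem
    · rcases Finset.mem_insert.1 ha with rfl | ha
      · exact e.2
      · rw [Finset.mem_singleton.1 ha]; exact f.2
    · rcases Finset.mem_insert.1 hb with rfl | hb
      · exact e.2
      · rw [Finset.mem_singleton.1 hb]; exact f.2

/-- Idempotents are always compatible, so the join exists in `S`; it lies below `1`, hence is
idempotent. -/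
theorem exists_isLUB_pair (e f : Idem S) : ∃ j : Idem S, IsLUB {(e : S), (f : S)} (j : S) := by
  classical
  obtain ⟨j, hj⟩ := DistributiveInverseMonoid.exists_join ({(e : S), (f : S)} : Finset S) (by
    intro a ha b hb
    apply compatible_of_idem
    · rcases Finset.mem_insert.1 ha with rfl | ha
      · exact e.2
      · rw [Finset.mem_singleton.1 ha]; exact f.2
    · rcases Finset.mem_insert.1 hb with rfl | hb
      · exact e.2
      · rw [Finset.mem_singleton.1 hb]; exact f.2)
  have hj1 : j ≤ 1 := hj.2 (by
    intro a ha
    simp only [Finset.coe_insert, Finset.coe_singleton, mem_insert_iff, mem_singleton_iff] at ha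
    rcases ha with rfl | rfl
    · exact e.coe_le_one
    · exact f.coe_le_one)
  exact ⟨⟨j, isIdempotentElem_of_le_one hj1⟩, by simpa using hj⟩

/-- The join of two idempotents corresponds to the union of the associated open sets. -/
theorem D_isLUB {e f j : Idem S} (h : IsLUB {(e : S), (f : S)} (j : S)) : D j = D e ∪ D f := by
  have hej : e ≤ j := h.1 (by simp)
  have hfj : f ≤ j := h.1 (by simp)
  refine Subset.antisymm ?_ (union_subset (D_mono hej) (D_mono hfj))
  intro x hx
  by_contra hn
  have hn' : e ∉ x.1 ∧ f ∉ x.1 := not_or.1 hn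
  -- Containing `j` but neither `e` nor `f` is an open condition, so a tight filter satisfying it
  -- can be replaced by an ultrafilter. That ultrafilter contains `a`, `b` annihilating `e`, `f`,
  -- and then `a * b * j = 0` by distributivity.
  obtain ⟨ξ, ⟨⟨hj, he⟩, hf⟩, hξ⟩ := mem_closure_iff.1 x.2 _
    (((isOpen_setOf_mem j).inter (isOpen_setOf_notMem e)).inter (isOpen_setOf_notMem f))
    ⟨⟨hx, hn'.1⟩, hn'.2⟩
  have key : ∀ g : Idem S, g ∉ ξ → ∃ a ∈ ξ, (a : S) * (g : S) = 0 := by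
    intro g hg
    by_contra! hc
    exact hg (hξ.mem_of_forall_mul_ne_zero hc)
  obtain ⟨a, ha, hae⟩ := key e he
  obtain ⟨b, hb, hbf⟩ := key f hf
  refine ξ.ne_zero _ (ξ.mul_mem _ (ξ.mul_mem a ha b hb) j hj) ?_
  have h1 := isLUB_mul_pair h ((a : S) * (b : S))
  have h2 : (a : S) * (b : S) * (e : S) = 0 := by
    rw [idem_comm a.2 b.2, mul_assoc, hae, mul_zero]
  have h3 : (a : S) * (b : S) * (f : S) = 0 := by rw [mul_assoc, hbf, mul_zero]
  rw [h2, h3] at h1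
  exact le_antisymm (h1.2 (by simp [upperBounds])) (zero_le_of_inverseMonoid _)

theorem exists_idem_compl (e : Idem S) :
    ∃ f : Idem S, (e : S) * (f : S) = 0 ∧ IsLUB {(e : S), (f : S)} ((1 : Idem S) : S) := by
  obtain ⟨f, hf, h1, h2⟩ := BooleanInverseMonoid.exists_compl (e : S) e.2
  exact ⟨⟨f, hf⟩, h1, h2⟩

theorem exists_D_eq_compl (e : Idem S) : ∃ f : Idem S, D f = (D e)ᶜ := by
  obtain ⟨f, h0, h1⟩ := exists_idem_compl e
  refine ⟨f, (IsCompl.compl_eq ⟨?_, ?_⟩).symm⟩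
  · rw [disjoint_iff_inter_eq_empty, ← D_mul, D_eq_empty]
    exact h0
  · rw [codisjoint_iff]
    exact (D_isLUB h1).symm.trans D_one

/-- If `D e ⊆ D f` and `g` is the complement of `f`, then `D (e * g)` is empty, so `e * g = 0`;
distributing `e` over `f ∨ g = 1` gives `e ≤ f`. -/
theorem D_injective : Function.Injective (D (S := S)) := by
  have key : ∀ e f : Idem S, D e ⊆ D f → e ≤ f := by
    intro e f h
    obtain ⟨g, hg0, hg⟩ := exists_idem_compl f
    have h0 : (e : S) * (g : S) = 0 := by
      change ((e * g : Idem S) : S) = 0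
      rw [← D_eq_empty, D_mul]
      refine eq_empty_of_forall_notMem fun x hx => ?_
      have : x ∈ D (f * g) := (mem_D_mul _ _ _).2 ⟨h hx.1, hx.2⟩
      rw [D_eq_empty.2 hg0] at this
      exact this
    have h1 := isLUB_mul_pair hg (e : S)
    rw [h0, Idem.coe_one, mul_one] at h1
    rw [Idem.le_iff]
    rw [idem_comm f.2 e.2]
    refine le_antisymm (Idem.mul_le_left e f) (h1.2 ?_)
    intro a ha
    simp only [mem_insert_iff, mem_singleton_iff] at ha
    rcases ha with rfl | rfl
    · exact le_rfl
    · exact zero_le_of_inverseMonoid _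
  exact fun e f h => le_antisymm (key e f h.le) (key f e h.ge)

/-- A basic set `U(X, Y)` is cut out by finitely many sets `D f` and complements of such sets.
Complements are again of the form `D f'`, and products of idempotents give intersections. -/
theorem isTopologicalBasis_range_D :
    TopologicalSpace.IsTopologicalBasis (range (D (S := S))) := by
  classical
  refine TopologicalSpace.isTopologicalBasis_of_isOpen_of_nhds ?_ ?_
  · rintro _ ⟨e, rfl⟩
    exact isOpen_D e
  · intro x u hx hu
    obtain ⟨v, hv, rfl⟩ := isOpen_induced_iff.1 hu
    obtain ⟨_, ⟨X, Y, rfl⟩, ⟨hX, hY⟩, hsub⟩ := basicSet_isBasis.exists_subset_of_mem_open hx hv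
    have h1 : ∃ e : Idem S, x ∈ D e ∧ ∀ y ∈ D e, ∀ f ∈ X, f ∈ y.1 := by
      clear hsub
      induction X using Finset.induction with
      | empty => exact ⟨1, by simp, by simp⟩
      | insert f X _ ih =>
        obtain ⟨e, he, h⟩ := ih fun g hg => hX g (Finset.mem_insert_of_mem hg)
        refine ⟨f * e, (mem_D_mul _ _ _).2 ⟨hX f (Finset.mem_insert_self _ _), he⟩, ?_⟩
        intro y hy g hg
        have hy' := (mem_D_mul _ _ _).1 hy
        rcases Finset.mem_insert.1 hg with rfl | hg
        · exact hy'.1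
        · exact h y hy'.2 g hg
    have h2 : ∃ e : Idem S, x ∈ D e ∧ ∀ y ∈ D e, ∀ f ∈ Y, f ∉ y.1 := by
      clear hsub
      induction Y using Finset.induction with
      | empty => exact ⟨1, by simp, by simp⟩
      | insert f Y _ ih =>
        obtain ⟨e, he, h⟩ := ih fun g hg => hY g (Finset.mem_insert_of_mem hg)
        obtain ⟨f', hf'⟩ := exists_D_eq_compl f
        refine ⟨f' * e, (mem_D_mul _ _ _).2 ⟨?_, he⟩, ?_⟩
        · rw [hf']
          exact hY f (Finset.mem_insert_self _ _)
        intro y hy g hg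
        have hy' := (mem_D_mul _ _ _).1 hy
        rw [hf'] at hy'
        rcases Finset.mem_insert.1 hg with rfl | hg
        · exact hy'.1
        · exact h y hy'.2 g hg
    obtain ⟨e, he, h1⟩ := h1
    obtain ⟨f, hf, h2⟩ := h2
    refine ⟨_, ⟨e * f, rfl⟩, (mem_D_mul _ _ _).2 ⟨he, hf⟩, fun y hy => hsub ?_⟩
    have hy' := (mem_D_mul _ _ _).1 hy
    exact ⟨h1 y hy'.1, h2 y hy'.2⟩

instance : T2Space (TightSpectrum S) := by
  refine ⟨fun x y hxy => ?_⟩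
  have : ∃ e, ¬(x ∈ D e ↔ y ∈ D e) := by
    by_contra! h
    exact hxy (theta_ext h)
  obtain ⟨e, he⟩ := this
  by_cases hx : x ∈ D e
  · exact ⟨_, _, isOpen_D e, (isClosed_D e).isOpen_compl, hx, by tauto, disjoint_compl_right⟩
  · exact ⟨_, _, (isClosed_D e).isOpen_compl, isOpen_D e, hx, by tauto, disjoint_compl_left⟩

instance [Countable S] : SecondCountableTopology (TightSpectrum S) :=
  isTopologicalBasis_range_D.secondCountableTopology (countable_range _)

theorem borel_eq_generateFrom_range_D [Countable S] :
    (inferInstance : MeasurableSpace (TightSpectrum S)) =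
      MeasurableSpace.generateFrom (range (D (S := S))) :=
  isTopologicalBasis_range_D.borel_eq_generateFrom

theorem isPiSystem_range_D : IsPiSystem (range (D (S := S))) := by
  rintro _ ⟨e, rfl⟩ _ ⟨f, rfl⟩ _
  exact ⟨e * f, D_mul e f⟩

end Boolean

open MeasureTheory CategoryTheory

/-! ### Arrows as germs, basic bisections and the partial maps `θ_s`. -/

section Bisections

variable {S : Type u} [InverseMonoidWithZero S]

/-- The membership proof carried by `theta` depends on `s` and `x`, which obstructs direct
rewriting. -/
theorem theta_congr {s t : S} {x y : TightSpectrum S} (hst : s = t) (hxy : x = y)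
    (hx : x ∈ D (dom s)) (hy : y ∈ D (dom t)) : theta s x hx = theta t y hy := by
  subst hst; subst hxy; rfl

theorem theta_theta_inv (s : S) (y : TightSpectrum S) (hy : y ∈ D (dom s⁻¹))
    (h : theta s⁻¹ y hy ∈ D (dom s)) : theta s (theta s⁻¹ y hy) h = y :=
  (theta_congr (inv_inv' s).symm rfl h (mem_D_dom_inv _ _ _)).trans
    (theta_inv s⁻¹ y hy (mem_D_dom_inv _ _ _))

theorem theta_inv_mem (s : S) (y : TightSpectrum S) (hy : y ∈ D (dom s⁻¹)) :
    theta s⁻¹ y hy ∈ D (dom s) := by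
  have h := mem_D_dom_inv s⁻¹ y hy
  rwa [inv_inv'] at h

theorem theta_mem_D_ran (s : S) (x : TightSpectrum S) (hx : x ∈ D (dom s)) :
    theta s x hx ∈ D (ran s) := by
  rw [← dom_inv]
  exact mem_D_dom_inv s x hx

/-- The arrow of the tight groupoid given by the germ `[s, x]`. -/
noncomputable def germArrow (s : S) (x : TightSpectrum S) (hx : x ∈ D (dom s)) : Arrow (TightSpectrum S) :=
  Arrow.mk (X := x) (Y := theta s x hx) ⟨germ s x hx, rfl, rfl⟩

theorem eq_germArrow {γ : Arrow (TightSpectrum S)} {s : S} {x : TightSpectrum S}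
    {hx : x ∈ D (dom s)} (h : γ.hom.1 = germ s x hx) : γ = germArrow s x hx := by
  obtain ⟨a, b, ⟨g, h1, h2⟩⟩ := γ
  change g = _ at h
  subst h
  change x = a at h1
  change theta s x hx = b at h2
  subst h1; subst h2
  rfl

theorem exists_eq_germArrow (γ : Arrow (TightSpectrum S)) :
    ∃ (s : S) (x : TightSpectrum S) (hx : x ∈ D (dom s)), γ = germArrow s x hx := by
  obtain ⟨s, x, hx, h⟩ : ∃ (s : S) (x : TightSpectrum S) (hx : x ∈ D (dom s)),
      γ.hom.1 = germ s x hx :=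
    germ_ind (P := fun g => ∃ (s : S) (x : TightSpectrum S) (hx : x ∈ D (dom s)),
      g = germ s x hx) (fun s x hx => ⟨s, x, hx, rfl⟩) γ.hom.1
  exact ⟨s, x, hx, eq_germArrow h⟩

theorem mem_Theta {s : S} {U : Set (TightSpectrum S)} {hU : U ⊆ D (dom s)}
    {γ : Arrow (TightSpectrum S)} :
    γ ∈ Theta s U hU ↔ ∃ (x : TightSpectrum S) (hx : x ∈ U), γ = germArrow s x (hU hx) :=
  ⟨fun ⟨x, hx, h⟩ => ⟨x, hx, eq_germArrow h⟩, by rintro ⟨x, hx, rfl⟩; exact ⟨x, hx, rfl⟩⟩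

/-- A germ of `s` is determined by its source, and `θ_s` is injective because `θ_{s⁻¹}` undoes it.
-/
theorem isBisection_Theta (s : S) : IsBisection (Theta s (D (dom s)) le_rfl) := by
  refine ⟨TopologicalSpace.isOpen_generateFrom_of_mem ⟨s, _, _, isOpen_D _, rfl⟩, ?_, ?_⟩
  · intro γ hγ η hη h
    obtain ⟨x, hx, rfl⟩ := mem_Theta.1 hγ
    obtain ⟨y, hy, rfl⟩ := mem_Theta.1 hη
    change theta s x hx = theta s y hy at h
    have hxy : x = y := by
      rw [← theta_inv s x hx (mem_D_dom_inv _ _ _), ← theta_inv s y hy (mem_D_dom_inv _ _ _)]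
      exact theta_congr rfl h _ _
    subst hxy
    rfl
  · intro γ hγ η hη h
    obtain ⟨x, hx, rfl⟩ := mem_Theta.1 hγ
    obtain ⟨y, hy, rfl⟩ := mem_Theta.1 hη
    obtain rfl : x = y := h
    rfl

theorem image_left_Theta (s : S) (U : Set (TightSpectrum S)) (hU : U ⊆ D (dom s)) :
    (fun γ : Arrow (TightSpectrum S) => γ.left) '' Theta s U hU = U := by
  ext x
  constructor
  · rintro ⟨γ, hγ, rfl⟩
    obtain ⟨x, hx, rfl⟩ := mem_Theta.1 hγ
    exact hx
  · intro hx
    exact ⟨germArrow s x (hU hx), mem_Theta.2 ⟨x, hx, rfl⟩, rfl⟩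

theorem image_right_Theta (s : S) :
    (fun γ : Arrow (TightSpectrum S) => γ.right) '' Theta s (D (dom s)) le_rfl = D (ran s) := by
  ext y
  constructor
  · rintro ⟨γ, hγ, rfl⟩
    obtain ⟨x, hx, rfl⟩ := mem_Theta.1 hγ
    exact theta_mem_D_ran s x hx
  · intro hy
    rw [← dom_inv] at hy
    have h := theta_inv_mem s y hy
    exact ⟨germArrow s _ h, mem_Theta.2 ⟨_, h, rfl⟩, theta_theta_inv s y hy h⟩

/-- The extension of `θ_s` to a map on the whole spectrum, by the identity off its domain. -/
noncomputable def thetaExt (s : S) (x : TightSpectrum S) : TightSpectrum S :=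
  open Classical in if hx : x ∈ D (dom s) then theta s x hx else x

theorem thetaExt_of_mem {s : S} {x : TightSpectrum S} (hx : x ∈ D (dom s)) :
    thetaExt s x = theta s x hx := dif_pos hx

theorem thetaExt_preimage_D (s : S) (e : Idem S) :
    thetaExt s ⁻¹' D e = D (dom s) ∩ D (conj s⁻¹ e) ∪ (D (dom s))ᶜ ∩ D e := by
  ext x
  by_cases hx : x ∈ D (dom s)
  · simp [hx, thetaExt, mem_D_theta]
  · simp [hx, thetaExt]

/-- Presents the image `θ_s(W)` as part of a preimage under `thetaExt s⁻¹`, so that its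
measurability and measure can be handled by pushforwards. -/
theorem mem_inter_preimage_thetaExt {s : S} {W : Set (TightSpectrum S)} (hW : W ⊆ D (dom s))
    (y : TightSpectrum S) :
    y ∈ D (ran s) ∩ thetaExt s⁻¹ ⁻¹' W ↔ ∃ (x : TightSpectrum S) (hx : x ∈ W),
      theta s x (hW hx) = y := by
  constructor
  · rintro ⟨hy, hyW⟩
    rw [← dom_inv] at hy
    rw [mem_preimage, thetaExt_of_mem hy] at hyW
    exact ⟨_, hyW, theta_theta_inv s y hy _⟩
  · rintro ⟨x, hx, rfl⟩
    refine ⟨theta_mem_D_ran s x (hW hx), ?_⟩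
    rw [mem_preimage, thetaExt_of_mem (mem_D_dom_inv s x (hW hx)), theta_inv]
    exact hx

end Bisections

/-! ### Local structure of open sets of arrows, the ring of sets `D e`, and affinity of `eta`. -/

section Measures

variable {S : Type u} [BooleanInverseMonoid S]

/-- An open set of arrows is a union of sets `Θ(s, D_e)`. -/
theorem exists_Theta_subset {U : Set (Arrow (TightSpectrum S))} (hU : IsOpen U) {s : S}
    {x : TightSpectrum S} {hx : x ∈ D (dom s)} (h : germArrow s x hx ∈ U) :
    ∃ (e : Idem S) (he : e ≤ dom s), x ∈ D e ∧ Theta s (D e) (D_mono he) ⊆ U := by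
  induction hU with
  | basic V hV =>
    obtain ⟨t, W, hW, hWo, rfl⟩ := hV
    obtain ⟨y, hy, heq⟩ := h
    -- `s` and `t` agree on `f`, so over the part of `D f` inside `W` and the domain of `s`, the
    -- germs of `s` are germs of `t`.
    obtain ⟨hxy, f, hf, hxf⟩ := (germ_eq hx (hW hy)).1 heq
    subst hxy
    obtain ⟨_, ⟨g, rfl⟩, hxg, hgW⟩ := isTopologicalBasis_range_D.exists_subset_of_mem_open hy hWo
    refine ⟨dom s * (f * g), Idem.mul_le_left _ _,
      (mem_D_mul _ _ _).2 ⟨hx, (mem_D_mul _ _ _).2 ⟨hxf, hxg⟩⟩, ?_⟩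
    rintro γ ⟨z, hz, hγ⟩
    have hz' := (mem_D_mul _ _ _).1 ((mem_D_mul _ _ _).1 hz).2
    exact ⟨z, hgW hz'.2, hγ.trans ((germ_eq _ _).2 ⟨rfl, f, hf, hz'.1⟩)⟩
  | univ => exact ⟨dom s, le_rfl, hx, subset_univ _⟩
  | inter V V' _ _ ih ih' =>
    obtain ⟨e, he, hxe, hV⟩ := ih h.1
    obtain ⟨e', he', hxe', hV'⟩ := ih' h.2
    refine ⟨e * e', (Idem.mul_le_left e e').trans he, (mem_D_mul _ _ _).2 ⟨hxe, hxe'⟩, ?_⟩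
    rintro γ ⟨z, hz, hγ⟩
    have hz' := (mem_D_mul _ _ _).1 hz
    exact ⟨hV ⟨z, hz'.1, hγ⟩, hV' ⟨z, hz'.2, hγ⟩⟩
  | sUnion A _ ih =>
    obtain ⟨V, hVA, hV⟩ := h
    obtain ⟨e, he, hxe, hsub⟩ := ih V hVA hV
    exact ⟨e, he, hxe, hsub.trans (subset_sUnion_of_mem hVA)⟩

theorem coe_eta (ν : Measure (TightSpectrum S)) [IsFiniteMeasure ν] (e : Idem S) :
    (eta ν e : ENNReal) = ν (D e) :=
  ENNReal.coe_toNNReal (measure_ne_top ν _)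

theorem isSetRing_range_D : IsSetRing (range (D (S := S))) where
  empty_mem := ⟨0, D_eq_empty.2 rfl⟩
  union_mem := by
    rintro _ _ ⟨e, rfl⟩ ⟨f, rfl⟩
    obtain ⟨j, hj⟩ := exists_isLUB_pair e f
    exact ⟨j, D_isLUB hj⟩
  sdiff_mem := by
    rintro _ _ ⟨e, rfl⟩ ⟨f, rfl⟩
    obtain ⟨g, hg⟩ := exists_D_eq_compl f
    exact ⟨e * g, by rw [D_mul, hg, sdiff_eq]⟩

theorem convex_normalizedInvariantMeans : Convex ℝ≥0 (NormalizedInvariantMeans S) := by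
  intro μ hμ κ hκ a b _ _ hab
  have h1 : (a • μ + b • κ) 1 = 1 := by simp [hμ.2, hκ.2, hab]
  refine ⟨⟨?_, ?_, ?_⟩, h1⟩
  · intro h0
    rw [h0] at h1
    exact zero_ne_one h1
  · intro s
    simp [hμ.1.invariant s, hκ.1.invariant s]
  · intro e f g h0 h
    simp [hμ.1.additive e f g h0 h, hκ.1.additive e f g h0 h]
    ring

theorem eta_add_smul {ν κ : Measure (TightSpectrum S)} [IsFiniteMeasure ν] [IsFiniteMeasure κ]
    (a b : ℝ≥0) : eta (a • ν + b • κ) = a • eta ν + b • eta κ := by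
  funext e
  rw [← ENNReal.coe_inj, coe_eta, Measure.add_apply, Measure.smul_apply, Measure.smul_apply,
    ← coe_eta ν, ← coe_eta κ, ENNReal.smul_def, ENNReal.smul_def, Pi.add_apply, Pi.smul_apply,
    Pi.smul_apply, smul_eq_mul, smul_eq_mul, smul_eq_mul, smul_eq_mul, ENNReal.coe_add,
    ENNReal.coe_mul, ENNReal.coe_mul]

/-! ### Invariance on bisections, existence and uniqueness of the measure for countable `S`. -/

variable [Countable S]

theorem measurable_thetaExt (s : S) : Measurable (thetaExt s) := by
  have h : Measurable[_, MeasurableSpace.generateFrom (range (D (S := S)))] (thetaExt s) := by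
    apply measurable_generateFrom
    rintro _ ⟨e, rfl⟩
    rw [thetaExt_preimage_D]
    exact ((measurableSet_D _).inter (measurableSet_D _)).union
      ((measurableSet_D _).compl.inter (measurableSet_D _))
  rwa [← borel_eq_generateFrom_range_D] at h

/-- A finite measure invariant on the sets `D_e` is invariant under the partial maps `θ_s`. -/
theorem measure_inter_preimage_thetaExt {ν : Measure (TightSpectrum S)} [IsFiniteMeasure ν]
    (hν : ∀ s : S, ν (D (ran s)) = ν (D (dom s))) (s : S) {W : Set (TightSpectrum S)}
    (hW : MeasurableSet W) : ν (D (ran s) ∩ thetaExt s⁻¹ ⁻¹' W) = ν (D (dom s) ∩ W) := by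
  have hD : ∀ e : Idem S, ν (D (ran s) ∩ thetaExt s⁻¹ ⁻¹' D e) = ν (D (dom s) ∩ D e) := by
    intro e
    -- `θ_s` maps `D (dom s * e)` onto the range set of the restriction `s * (dom s * e)`, to which
    -- the hypothesis `hν` applies.
    have h1 : D (ran s) ∩ thetaExt s⁻¹ ⁻¹' D e = D (ran (s * ((dom s * e : Idem S) : S))) := by
      rw [thetaExt_preimage_D, inv_inv', dom_inv, inter_union_distrib_left, ← inter_assoc,
        inter_self, ← inter_assoc, inter_compl_self, empty_inter, union_empty,
        inter_eq_self_of_subset_right (D_mono (conj_le_ran s e)), ran_mul_idem,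
        ← conj_idem (dom s) e, conj_conj]
      simp only [dom, ← mul_assoc, mul_inv_mul]
    rw [h1, hν, dom_mul_idem s (Idem.mul_le_left _ _), D_mul]
  -- Two finite measures that agree on the π-system of sets `D e`; equality of total masses is the
  -- case `e = 1`.
  have hmap : (ν.restrict (D (ran s))).map (thetaExt s⁻¹) = ν.restrict (D (dom s)) := by
    have happ : ∀ V, MeasurableSet V → (ν.restrict (D (ran s))).map (thetaExt s⁻¹) V =
        ν (D (ran s) ∩ thetaExt s⁻¹ ⁻¹' V) := fun V hV => by
      rw [Measure.map_apply (measurable_thetaExt _) hV,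
        Measure.restrict_apply (measurable_thetaExt _ hV), inter_comm]
    have hgen : ∀ V ∈ range (D (S := S)), (ν.restrict (D (ran s))).map (thetaExt s⁻¹) V =
        ν.restrict (D (dom s)) V := by
      rintro _ ⟨e, rfl⟩
      rw [happ _ (measurableSet_D e), hD, Measure.restrict_apply (measurableSet_D e), inter_comm]
    refine ext_of_generate_finite _ borel_eq_generateFrom_range_D isPiSystem_range_D hgen ?_
    rw [← D_one]
    exact hgen _ ⟨1, rfl⟩
  have h := congrArg (fun κ : Measure (TightSpectrum S) => κ W) hmap
  rwa [Measure.map_apply (measurable_thetaExt _) hW,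
    Measure.restrict_apply (measurable_thetaExt _ hW), Measure.restrict_apply hW, inter_comm,
    inter_comm W] at h

/-- The bisection is covered by countably many sets `Theta s (D e)`. Making their sources disjoint
partitions it: injectivity of `d` ensures that no arrow is lost, injectivity of `r` that the ranges
are disjoint too. Each piece has range and source of equal measure. -/
theorem measure_image_right_eq_image_left {ν : Measure (TightSpectrum S)} [IsFiniteMeasure ν]
    (hν : ∀ s : S, ν (D (ran s)) = ν (D (dom s))) {U : Set (Arrow (TightSpectrum S))}
    (hU : IsBisection U) :
    ν ((fun γ : Arrow (TightSpectrum S) => γ.right) '' U) =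
      ν ((fun γ : Arrow (TightSpectrum S) => γ.left) '' U) := by
  obtain ⟨hUo, hr, hl⟩ := hU
  let I := {p : S × Idem S // ∃ h : p.2 ≤ dom p.1, Theta p.1 (D p.2) (D_mono h) ⊆ U}
  -- An arrow of `U` supplies an element of `I`, needed to enumerate `I` by a surjection from `ℕ`.
  rcases U.eq_empty_or_nonempty with rfl | ⟨γ₀, hγ₀⟩
  · simp
  have hmem : ∀ γ ∈ U, ∃ (p : I) (x : TightSpectrum S) (hx : x ∈ D p.1.2),
      γ = germArrow p.1.1 x (D_mono p.2.1 hx) := by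
    intro γ hγ
    obtain ⟨s, x, hx, rfl⟩ := exists_eq_germArrow γ
    obtain ⟨e, he, hxe, hsub⟩ := exists_Theta_subset hUo hγ
    exact ⟨⟨(s, e), he, hsub⟩, x, hxe, rfl⟩
  obtain ⟨p₀, -⟩ := hmem γ₀ hγ₀
  have : Nonempty I := ⟨p₀⟩
  obtain ⟨f, hf⟩ := exists_surjective_nat I
  let W : ℕ → Set (TightSpectrum S) := disjointed fun n => D (f n).1.2
  have hWD : ∀ n, W n ⊆ D (dom (f n).1.1) := fun n =>
    (disjointed_subset _ n).trans (D_mono (f n).2.1)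
  have hWm : ∀ n, MeasurableSet (W n) := MeasurableSet.disjointed fun n => measurableSet_D _
  have hWd : Pairwise (Function.onFun Disjoint W) := disjoint_disjointed _
  have hWU : ∀ n x (hx : x ∈ W n), germArrow (f n).1.1 x (hWD n hx) ∈ U := fun n x hx =>
    (f n).2.2 (mem_Theta.2 ⟨x, disjointed_subset _ n hx, rfl⟩)
  have hcover : ∀ γ ∈ U, ∃ (n : ℕ) (x : TightSpectrum S) (hx : x ∈ W n),
      γ = germArrow (f n).1.1 x (hWD n hx) := by
    intro γ hγ
    obtain ⟨p, x, hx, rfl⟩ := hmem γ hγ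
    obtain ⟨k, rfl⟩ := hf p
    have hxW : x ∈ ⋃ n, W n := by
      rw [iUnion_disjointed]
      exact mem_iUnion.2 ⟨k, hx⟩
    obtain ⟨n, hn⟩ := mem_iUnion.1 hxW
    -- The piece `n` containing `x` may come from another element of `S`, but its germ at `x` also
    -- lies in `U` and has the same source, so it is the same arrow.
    exact ⟨n, x, hn, hl hγ (hWU n x hn) rfl⟩
  have hleft : (fun γ : Arrow (TightSpectrum S) => γ.left) '' U = ⋃ n, W n := by
    ext x
    rw [mem_iUnion]
    constructor
    · rintro ⟨γ, hγ, rfl⟩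
      obtain ⟨n, x, hx, rfl⟩ := hcover γ hγ
      exact ⟨n, hx⟩
    · rintro ⟨n, hx⟩
      exact ⟨_, hWU n x hx, rfl⟩
  have hright : (fun γ : Arrow (TightSpectrum S) => γ.right) '' U =
      ⋃ n, D (ran (f n).1.1) ∩ thetaExt (f n).1.1⁻¹ ⁻¹' W n := by
    ext y
    simp only [mem_iUnion, mem_inter_preimage_thetaExt (hWD _)]
    constructor
    · rintro ⟨γ, hγ, rfl⟩
      obtain ⟨n, x, hx, rfl⟩ := hcover γ hγ
      exact ⟨n, x, hx, rfl⟩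
    · rintro ⟨n, x, hx, rfl⟩
      exact ⟨_, hWU n x hx, rfl⟩
  have hdisj : Pairwise (Function.onFun Disjoint
      fun n => D (ran (f n).1.1) ∩ thetaExt (f n).1.1⁻¹ ⁻¹' W n) := by
    intro n k hnk
    refine Set.disjoint_left.2 fun y hn hk => ?_
    obtain ⟨x, hx, hxy⟩ := (mem_inter_preimage_thetaExt (hWD n) y).1 hn
    obtain ⟨x', hx', hxy'⟩ := (mem_inter_preimage_thetaExt (hWD k) y).1 hk
    have h := hr (hWU n x hx) (hWU k x' hx') (hxy.trans hxy'.symm)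
    obtain rfl : x = x' := congrArg (fun γ : Arrow (TightSpectrum S) => γ.left) h
    exact Set.disjoint_left.1 (hWd hnk) hx hx'
  rw [hleft, hright, measure_iUnion hWd hWm, measure_iUnion hdisj fun n =>
    (measurableSet_D _).inter (measurable_thetaExt _ (hWm n))]
  refine tsum_congr fun n => ?_
  rw [measure_inter_preimage_thetaExt hν _ (hWm n), inter_eq_self_of_subset_right (hWD n)]

/-- Regularity drops out because the spectrum is compact, Hausdorff and second countable; invariance
needs testing only on the bisections `Theta s (D (dom s))`. -/
theorem mem_IM_iff {ν : Measure (TightSpectrum S)} :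
    ν ∈ IM (TightSpectrum S) ↔
      IsProbabilityMeasure ν ∧ ∀ s : S, ν (D (ran s)) = ν (D (dom s)) := by
  constructor
  · rintro ⟨h1, -, h2⟩
    refine ⟨h1, fun s => ?_⟩
    have := h2 _ (isBisection_Theta s)
    rwa [image_left_Theta, image_right_Theta] at this
  · rintro ⟨h1, h2⟩
    exact ⟨h1, inferInstance, fun U hU => measure_image_right_eq_image_left h2 hU⟩

theorem eta_mem_normalizedInvariantMeans {ν : Measure (TightSpectrum S)}
    (hν : ν ∈ IM (TightSpectrum S)) : eta ν ∈ NormalizedInvariantMeans S := by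
  obtain ⟨hp, hinv⟩ := mem_IM_iff.1 hν
  have h1 : eta ν 1 = 1 := by
    rw [← ENNReal.coe_inj, coe_eta, D_one, measure_univ, ENNReal.coe_one]
  refine ⟨⟨?_, ?_, ?_⟩, h1⟩
  · intro h0
    rw [h0] at h1
    exact zero_ne_one h1
  · intro s
    rw [← ENNReal.coe_inj, coe_eta, coe_eta, hinv]
  · intro e f g h0 h
    rw [← ENNReal.coe_inj, ENNReal.coe_add, coe_eta, coe_eta, coe_eta, D_isLUB h,
      measure_union ?_ (measurableSet_D f)]
    rw [disjoint_iff_inter_eq_empty, ← D_mul, D_eq_empty]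
    exact h0

/-- Every normalized invariant mean comes from an invariant probability measure. -/
theorem exists_mem_IM_eta_eq {μ : Idem S → ℝ≥0} (hμ : μ ∈ NormalizedInvariantMeans S) :
    ∃ ν ∈ IM (TightSpectrum S), eta ν = μ := by
  obtain ⟨⟨-, hinv, hadd⟩, h1⟩ := hμ
  -- Well defined on the ring by injectivity of `D`; the value `0` off the ring plays no role.
  let m : Set (TightSpectrum S) → ENNReal := Function.extend D (fun e => (μ e : ENNReal)) 0
  have hm : ∀ e, m (D e) = μ e := fun e => D_injective.extend_apply _ _ e
  have hm0 : m ∅ = 0 := by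
    rw [← D_eq_empty.2 (Idem.coe_zero (S := S)), hm]
    -- Since `0 = 0 ∨ 0` is an orthogonal join, `μ 0 = μ 0 + μ 0`.
    have h := hadd 0 0 0 (by simp) (by simp)
    simpa using h
  let c : AddContent ENNReal (range (D (S := S))) :=
    isSetRing_range_D.addContent_of_union m hm0 (by
      rintro _ _ ⟨e, rfl⟩ ⟨f, rfl⟩ hef
      obtain ⟨j, hj⟩ := exists_isLUB_pair e f
      rw [← D_isLUB hj, hm, hm, hm, ← ENNReal.coe_add, hadd e f j ?_ hj]
      rw [disjoint_iff_inter_eq_empty, ← D_mul, D_eq_empty] at hef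
      exact hef)
  have hc : ∀ e, c (D e) = μ e := hm
  -- A countable union of sets `D g` that is itself some `D e` is compact with an open cover, so
  -- finitely many of them suffice and finite subadditivity applies.
  have hsub : c.IsSigmaSubadditive := by
    rintro f hf ⟨e, he⟩
    have hcpt : IsCompact (⋃ i, f i) := by
      rw [← he]
      exact (isClosed_D e).isCompact
    have hfo : ∀ i, IsOpen (f i) := fun i => by
      obtain ⟨g, hg⟩ := hf i
      rw [← hg]
      exact isOpen_D g
    obtain ⟨t, ht⟩ := hcpt.elim_finite_subcover f hfo le_rfl
    have hle : c (⋃ i, f i) ≤ ∑ i ∈ t, c (f i) := by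
      classical
      refine (addContent_le_sum_of_subset_sUnion (m := c) (J := t.image f)
        isSetRing_range_D.isSetSemiring ?_ ⟨e, he⟩ ?_).trans ?_
      · intro A hA
        obtain ⟨i, -, rfl⟩ := Finset.mem_image.1 (Finset.mem_coe.1 hA)
        exact hf i
      · simpa [sUnion_image] using ht
      -- Passing to `t.image f` merges equal sets, which can only decrease the sum.
      · exact Finset.sum_image_le_of_nonneg (fun _ _ => zero_le)
    exact hle.trans (ENNReal.sum_le_tsum t)
  let ν := c.measure isSetRing_range_D.isSetSemiring borel_eq_generateFrom_range_D.le hsub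
  have hν : ∀ e, ν (D e) = μ e := fun e =>
    (c.measure_eq isSetRing_range_D.isSetSemiring borel_eq_generateFrom_range_D hsub
      ⟨e, rfl⟩).trans (hc e)
  have hprob : IsProbabilityMeasure ν := ⟨by rw [← D_one, hν, h1, ENNReal.coe_one]⟩
  refine ⟨ν, mem_IM_iff.2 ⟨hprob, fun s => by rw [hν, hν, hinv]⟩, funext fun e => ?_⟩
  rw [← ENNReal.coe_inj, coe_eta, hν]

/-- The sets `D e` are a π-system generating the Borel sets, so their measures determine a
probability measure. -/
theorem eta_injOn : InjOn eta (IM (TightSpectrum S)) := by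
  intro ν hν κ hκ h
  have := hν.1
  have := hκ.1
  refine ext_of_generate_finite _ borel_eq_generateFrom_range_D isPiSystem_range_D ?_
    (by rw [measure_univ, measure_univ])
  rintro _ ⟨e, rfl⟩
  rw [← coe_eta, ← coe_eta, h]

theorem convex_IM : Convex ℝ≥0 (IM (TightSpectrum S)) := by
  intro ν hν κ hκ a b _ _ hab
  obtain ⟨h1, h2⟩ := mem_IM_iff.1 hν
  obtain ⟨h3, h4⟩ := mem_IM_iff.1 hκ
  refine mem_IM_iff.2 ⟨⟨?_⟩, fun s => ?_⟩
  · rw [Measure.add_apply, Measure.smul_apply, Measure.smul_apply, measure_univ, measure_univ,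
      ← add_smul, hab, one_smul]
  · rw [Measure.add_apply, Measure.add_apply, Measure.smul_apply, Measure.smul_apply,
      Measure.smul_apply, Measure.smul_apply, h2, h4]

end Measures

end InverseMonoids

open InverseMonoids
theorem mainTheorem5 (S : Type*) [BooleanInverseMonoid S] [Countable S] (hH : ConditionH S) :
    (∀ ν ∈ IM (TightSpectrum S), eta ν ∈ NormalizedInvariantMeans S) ∧
    Convex ℝ≥0 (IM (TightSpectrum S)) ∧
    Convex ℝ≥0 (NormalizedInvariantMeans S) ∧
    (∀ ν ∈ IM (TightSpectrum S), ∀ κ ∈ IM (TightSpectrum S), ∀ a b : ℝ≥0, a + b = 1 →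
      eta (a • ν + b • κ) = a • eta ν + b • eta κ) ∧
    Set.BijOn eta (IM (TightSpectrum S)) (NormalizedInvariantMeans S) := by
  refine ⟨fun ν hν => eta_mem_normalizedInvariantMeans hν, convex_IM,
    convex_normalizedInvariantMeans, ?_, fun ν hν => eta_mem_normalizedInvariantMeans hν,
    eta_injOn, fun μ hμ => exists_mem_IM_eta_eq hμ⟩
  intro ν hν κ hκ a b _
  have := hν.1
  have := hκ.1
  exact eta_add_smul a b
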